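/- **Setting.** Let $n\ge 1$, $L>0$, $R\ge 0$, $\epsilon>0$. Let $\mathcal X\subseteq\mathbb R^d$ be nonempty, closed and convex with diameter at most $R$, let $f_1,\dots,f_n:\mathbb R^d\to\mathbb R$ be convex and $L$-smooth (differentiable with $L$-Lipschitz gradient), and let $F=\frac1n\sum_{i}f_i$. A *query* is one evaluation of some $\nabla f_i$. $\mathsf{Proj}_{\mathcal X}$ is Euclidean projection onto $\mathcal X$. All random draws are independent. **OneEpochSvrg**$(\phi_1,\dots,\phi_n;\,x_{\rm full},x_{\rm init},\eta,N)$: compute $G=\frac1n\sum_i\nabla\phi_i(x_{\rm full})$; set $x_0=x_{\rm init}$; for $t=0,\dots,N-1$ draw $i_t$ uniformly from $\{1,\dots,n\}$ and set $x_{t+1}=\mathsf{Proj}_{\mathcal X}\big(x_t-\eta(\nabla\phi_{i_t}(x_t)-\nabla\phi_{i_t}(x_{\rm full})+G)\big)$; return $\frac1N\sum_{t=1}^{N}x_t$. **ApproxProx**$(s;x_{\rm init},x_{\rm prev})$: with $\lambda=L/n$, run OneEpochSvrg on $\phi_i(x)=f_i(x)+\frac\lambda2\|x-s\|^2$ with $x_{\rm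 full}=x_{\rm prev}$, initial point $x_{\rm init}$, $\eta=\frac1{32L}$, $N=\lceil 32/(\eta\lambda)\rceil$. **UnbiasedProx**$(s;x_{\rm prev})$: $x^{(0)}=$ ApproxProx$(s;s,x_{\rm prev})$; draw $J_+$ with $P(J_+=k)=2^{-(k+1)}$, $k\ge 0$, and set $J=2+J_+$; $x^{(j+1)}=$ ApproxProx$(s;x^{(j)},x^{(j)})$ for $0\le j<J$; return $x^{(2)}+2^{J_++1}\big(x^{(J)}-x^{(\max\{J-1,2\})}\big)$. **WarmStart-SVRG**: from an arbitrary $x_{\rm init}\in\mathcal X$, set $x^{(0)}=x_{\rm init}$ and, for $k=0,\dots,K_{\rm w}-1$, $x^{(k+1)}=$ OneEpochSvrg$(f_1,\dots,f_n;x^{(k)},x^{(k)},\eta_{k+1},32n)$ with $\eta_{k+1}=(8L\,n^{2^{-k-1}})^{-1}$; return $x^{(K_{\rm w})}$. Here $K_{\rm w}=\lceil\log_2\lceil\log_2 n\rceil\rceil+1$ (with $\log_2 0$ read as $0$), so $K_{\rm w}=O(\max\{1,\log\log n\})$. **RECAPP iterations** from $x_0=v_0$: with $\alpha_0=1$ and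 $\alpha_{t+1}\in[0,1]$ given by $\alpha_{t+1}^{-2}-\alpha_{t+1}^{-1}=\alpha_t^{-2}$, for $t=0,\dots,T-1$ set $s_t=(1-\alpha_{t+1})x_t+\alpha_{t+1}v_t$, $x_{t+1}=$ ApproxProx$(s_t;s_t,x_t)$, $\tilde x_{t+1}=$ UnbiasedProx$(s_t;x_t)$, $v_{t+1}=\mathsf{Proj}_{\mathcal X}\big(v_t-\alpha_{t+1}^{-1}(s_t-\tilde x_{t+1})\big)$; the result is $x_T$. **RECAPP** runs this from the output of WarmStart-SVRG. **Restarted RECAPP** calls WarmStart-SVRG once and then runs $K$ times $T$ RECAPP iterations, each run started (with $\alpha_0=1$ again) at the result of the previous one. **Theorem.** (1) There is a universal constant $C$ such that for all $n,L,R,\epsilon$ there is $T\le C\,R\sqrt{L/(n\epsilon)}$, depending only on $n,L,R,\epsilon$, such that for every $d$, $\mathcal X$, $f_1,\dots,f_n$ and $x_{\rm init}\in\mathcal X$ as above, RECAPP with $T$ iterations outputs $x\in\mathcal X$ with $\mathbb E F(x)-\min_{\mathcal X}F\le\epsilon$, and its expected number of queries is at most $$C\Big(n\max\{1,\log\log n\}+\sqrt{nLR^2/\epsilon}\Big).$$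 (2) For every $c>0$ there is a constant $C$, depending only on $c$, such that for all $n,L,R,\epsilon$ and $0<\gamma\le cL/n$ there are $T,K$, depending only on $n,L,R,\epsilon,\gamma$, such that for all $d$, $\mathcal X$, $f_1,\dots,f_n$, $x_{\rm init}\in\mathcal X$ as above for which $F$ is in addition $\gamma$-strongly convex on $\mathcal X$, restarted RECAPP outputs $x\in\mathcal X$ with $\mathbb E F(x)-\min_{\mathcal X}F\le\epsilon$, and its expected number of queries is at most $$C\Big(n\max\{1,\log\log n\}+\sqrt{nL/\gamma}\;\max\Big\{0,\log\frac{LR^2}{n\epsilon}\Big\}\Big).$$ Here $\max\{1,\log\log n\}$ is read as $1$ for $n\in\{1,2\}$. -/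

import Mathlib

open scoped ENNReal

noncomputable section

namespace Recapp

/-- The Euclidean space of dimension `d`. -/
abbrev Euc (d : ℕ) : Type := EuclideanSpace ℝ (Fin d)

/-! ### Randomized procedures that count gradient queries -/

/-- A randomized procedure with result in `α`: the joint law of the result and of the number of
component-gradient queries that were made. -/
def QueryM (α : Type) : Type := PMF (α × ℕ)

namespace QueryM

/-- The joint law of (result, number of queries). -/
def law {α : Type} (m : QueryM α) : PMF (α × ℕ) := m

/-- Sequential composition adds up the numbers of queries. -/
instance : Monad QueryM where
  pure a := PMF.pure (a, 0)
  bind m k := PMF.bind (m.law) fun z => PMF.map (fun w => (w.1, z.2 + w.2)) ((k z.1).law)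

/-- Draw a fresh sample from a distribution; this costs no query. -/
def sample {α : Type} (p : PMF α) : QueryM α := PMF.map (fun a => (a, 0)) p

/-- `for t = 0 to T - 1 do x ← body t x`, started at `x = init`. -/
def forLoop {α : Type} (body : ℕ → α → QueryM α) (init : α) : ℕ → QueryM α
  | 0 => pure init
  | T + 1 => do
      let x ← forLoop body init T
      body T x

/-- The expected number of queries. -/
def expectedQueries {α : Type} (m : QueryM α) : ℝ≥0∞ := ∑' z, m.law z * (z.2 : ℝ≥0∞)

/-- The expectation of a nonnegative function of the result. For a real function `g` the value is
`𝔼 [max (g x) 0]`. -/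
def expectation {α : Type} (m : QueryM α) (g : α → ℝ) : ℝ≥0∞ :=
  ∑' z, m.law z * ENNReal.ofReal (g z.1)

/-- Every possible result belongs to `S`. -/
def ResultIn {α : Type} (m : QueryM α) (S : Set α) : Prop := ∀ z ∈ m.law.support, z.1 ∈ S

end QueryM

open QueryM

/-- Access to the gradients of the components: `O i x` returns the gradient of the `i`-th
component at `x`. -/
abbrev Oracle (n d : ℕ) : Type := Fin n → Euc d → QueryM (Euc d)

/-- The gradient oracle of `f₁, …, fₙ`: each evaluation of a `∇ fᵢ` costs exactly one query. -/
def gradOracle {n d : ℕ} (f : Fin n → Euc d → ℝ) : Oracle n d :=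
  fun i x => (PMF.pure (gradient (f i) x, 1) : PMF (Euc d × ℕ))

/-- The gradient oracle of `φᵢ(x) = fᵢ(x) + (lam / 2) ‖x - s‖²`, from the one of the `fᵢ`. -/
def proxOracle {n d : ℕ} (O : Oracle n d) (lam : ℝ) (s : Euc d) : Oracle n d :=
  fun i x => do
    let g ← O i x
    pure (g + lam • (x - s))

/-- `(1 / n) ∑ᵢ ∇ φᵢ(x)`, computed with one query per component. -/
def fullGradient {n d : ℕ} (O : Oracle n d) (x : Euc d) : QueryM (Euc d) := do
  let total ← (List.finRange n).foldlM
    (fun (acc : Euc d) (i : Fin n) => do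
      let g ← O i x
      pure (acc + g)) (0 : Euc d)
  pure ((n : ℝ)⁻¹ • total)

/-- Euclidean projection: the nearest point of `X` to `x` (it exists and is unique when `X` is
nonempty, closed and convex). -/
def proj {d : ℕ} (X : Set (Euc d)) (x : Euc d) : Euc d :=
  open scoped Classical in
  if h : ∃ y ∈ X, ∀ z ∈ X, ‖x - y‖ ≤ ‖x - z‖ then h.choose else x

/-! ### One epoch of SVRG and its two uses -/

/-- One epoch of SVRG for `Φ = (1 / n) ∑ φᵢ` over `X`, given by the component gradients `O` of the
`φᵢ`, with center point `xfull`, initial point `xinit`, step size `η` and `T` iterations. The loop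
state is the current iterate `x_t` together with `x_1 + … + x_t`; the result is the average of
`x_1, …, x_T`. -/
def oneEpochSvrg {n d : ℕ} [NeZero n] (X : Set (Euc d)) (O : Oracle n d)
    (xfull xinit : Euc d) (η : ℝ) (T : ℕ) : QueryM (Euc d) := do
  let G ← fullGradient O xfull
  let z ← forLoop (fun _ (z : Euc d × Euc d) => do
      let i ← sample (PMF.uniformOfFintype (Fin n))
      let a ← O i z.1
      let b ← O i xfull
      let x := proj X (z.1 - η • (a - b + G))
      pure (x, z.2 + x)) (xinit, 0) T
  pure ((T : ℝ)⁻¹ • z.2)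

/-- `ApproxProx_{F,lam}(s; xinit, xprev)` by one epoch of SVRG centered at `xprev`, applied to
`φᵢ(x) = fᵢ(x) + (lam / 2) ‖x - s‖²`, with step size `η = 1 / (32 L)` and `⌈32 / (η lam)⌉`
iterations. -/
def approxProxSvrg {n d : ℕ} [NeZero n] (X : Set (Euc d)) (O : Oracle n d) (L lam : ℝ)
    (s xinit xprev : Euc d) : QueryM (Euc d) :=
  oneEpochSvrg X (proxOracle O lam s) xprev xinit (1 / (32 * L)) ⌈32 / (1 / (32 * L) * lam)⌉₊

/-- WarmStart-SVRG with `K` epochs of `T` iterations each; the `(k + 1)`-st epoch uses the step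
size `1 / (8 L n^(2^(-(k+1))))`, and the current point as both center and initial point. -/
def warmStartSvrg {n d : ℕ} [NeZero n] (X : Set (Euc d)) (O : Oracle n d) (L : ℝ) (T K : ℕ)
    (xinit : Euc d) : QueryM (Euc d) :=
  forLoop (fun k x =>
    oneEpochSvrg X O x x (8 * L * (n : ℝ) ^ ((1 / 2 : ℝ) ^ (k + 1)))⁻¹ T) xinit K

/-! ### RECAPP with an arbitrary implementation of `ApproxProx` -/

/-- The geometric distribution with parameter `1 / 2` on `{0, 1, 2, …}`: the probability of `k` is
`(1 / 2) * (1 / 2) ^ k`. -/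
def geomHalf : PMF ℕ :=
  ⟨fun k => 2⁻¹ * 2⁻¹ ^ k, by
    have h : ∑' k : ℕ, (2⁻¹ * 2⁻¹ ^ k : ℝ≥0∞) = 1 := by
      rw [ENNReal.tsum_mul_left, ENNReal.tsum_geometric, ENNReal.one_sub_inv_two, inv_inv]
      exact ENNReal.inv_mul_cancel (by norm_num) (by norm_num)
    exact h ▸ ENNReal.summable.hasSum⟩

/-- `UnbiasedProx` by multilevel Monte Carlo, with geometric parameter `p = 1 / 2` and offset `j₀`,
for prox center `s` and previous point `xprev`; `approx s xinit xprev` is the `ApproxProx` in use.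
With `x⁽⁰⁾ = approx s s xprev`, `x⁽ʲ⁺¹⁾ = approx s x⁽ʲ⁾ x⁽ʲ⁾`, and `J = j₀ + J₊`, the pair `w` below
is `(x⁽ᵐ⁾, x⁽ᴶ⁾)` with `m = max (J - 1) j₀`. -/
def unbiasedProx {d : ℕ} (approx : Euc d → Euc d → Euc d → QueryM (Euc d)) (j₀ : ℕ)
    (s xprev : Euc d) : QueryM (Euc d) := do
  let x0 ← approx s s xprev
  let Jp ← sample geomHalf
  let xj ← forLoop (fun _ x => approx s x x) x0 j₀
  let w ← forLoop (fun _ (w : Euc d × Euc d) => do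
      let x ← approx s w.2 w.2
      pure (w.2, x)) (xj, xj) Jp
  pure (xj + (geomHalf Jp).toReal⁻¹ • (w.2 - w.1))

/-- The coefficients `α_t`: `α_0 = 1`, and `α_{t+1} ∈ [0, 1]` is the solution of
`1 / α_{t+1}² - 1 / α_{t+1} = 1 / α_t²`, see `alpha_spec`. -/
def alpha : ℕ → ℝ
  | 0 => 1
  | t + 1 => 2 / (1 + √(1 + 4 / alpha t ^ 2))

theorem alpha_spec (t : ℕ) : alpha 0 = 1 ∧ alpha (t + 1) ∈ Set.Ioc (0 : ℝ) 1 ∧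
    1 / alpha (t + 1) ^ 2 - 1 / alpha (t + 1) = 1 / alpha t ^ 2 := by
  have hu : (0 : ℝ) ≤ 4 / alpha t ^ 2 := by positivity
  have hs := Real.sq_sqrt (show (0 : ℝ) ≤ 1 + 4 / alpha t ^ 2 by linarith)
  have h1 : (1 : ℝ) ≤ √(1 + 4 / alpha t ^ 2) := Real.one_le_sqrt.mpr (by linarith)
  refine ⟨rfl, ⟨?_, ?_⟩, ?_⟩
  · simp only [alpha]; positivity
  · simp only [alpha]
    rw [div_le_one (by positivity)]
    linarith
  · simp only [alpha]
    set q := √(1 + 4 / alpha t ^ 2) with hq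
    have : 1 / alpha t ^ 2 = (q ^ 2 - 1) / 4 := by rw [hs]; ring
    rw [this]
    have : (1 + q) ≠ 0 := by positivity
    field_simp
    ring

/-- `T` iterations of RECAPP from `x_0 = v_0 = xstart`, without the warm start. The loop state is
`(x_t, v_t)`, and `x_T` is returned. -/
def recappLoop {d : ℕ} (X : Set (Euc d)) (approx : Euc d → Euc d → Euc d → QueryM (Euc d))
    (j₀ T : ℕ) (xstart : Euc d) : QueryM (Euc d) := do
  let z ← forLoop (fun t (z : Euc d × Euc d) => do
      let s := (1 - alpha (t + 1)) • z.1 + alpha (t + 1) • z.2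
      let x ← approx s s z.1
      let xt ← unbiasedProx approx j₀ s z.1
      let v := proj X (z.2 - (alpha (t + 1))⁻¹ • (s - xt))
      pure (x, v)) (xstart, xstart) T
  pure z.1

/-- RECAPP with `T` iterations and the given `WarmStart`. -/
def recapp {d : ℕ} (X : Set (Euc d)) (warm : QueryM (Euc d))
    (approx : Euc d → Euc d → Euc d → QueryM (Euc d)) (j₀ T : ℕ) : QueryM (Euc d) := do
  let x0 ← warm
  recappLoop X approx j₀ T x0

/-- Restarted RECAPP: one warm start, then `K` runs of `T` iterations of RECAPP, each started (with
fresh coefficients `α_t`) at the result of the previous one. -/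
def restartedRecapp {d : ℕ} (X : Set (Euc d)) (warm : QueryM (Euc d))
    (approx : Euc d → Euc d → Euc d → QueryM (Euc d)) (j₀ T K : ℕ) : QueryM (Euc d) := do
  let x0 ← warm
  forLoop (fun _ x => recappLoop X approx j₀ T x) x0 K

/-! ### The finite-sum instance -/

/-- The objective `F = (1 / n) ∑ fᵢ`. -/
def objective {n d : ℕ} (f : Fin n → Euc d → ℝ) (x : Euc d) : ℝ := (n : ℝ)⁻¹ * ∑ i, f i x

/-- The finite-sum problem: `X` is closed and convex of diameter at most `R`, and the `fᵢ` are
convex and `L`-smooth. -/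
structure IsFiniteSumProblem {n d : ℕ} (X : Set (Euc d)) (f : Fin n → Euc d → ℝ) (L R : ℝ) :
    Prop where
  isClosed : IsClosed X
  convex : Convex ℝ X
  diam_le : ∀ x ∈ X, ∀ y ∈ X, ‖x - y‖ ≤ R
  convexOn : ∀ i, ConvexOn ℝ Set.univ (f i)
  differentiable : ∀ i, Differentiable ℝ (f i)
  smooth : ∀ i x y, ‖gradient (f i) x - gradient (f i) y‖ ≤ L * ‖x - y‖

/-- The number of epochs of the warm start: `⌈log₂ log₂ n⌉ + 1`. -/
def warmStartEpochs (n : ℕ) : ℕ := Nat.clog 2 (Nat.clog 2 n) + 1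

/-- RECAPP for the finite sum of the `fᵢ`: `lam = L / n`, one-epoch SVRG as `ApproxProx`, multilevel
Monte Carlo with offset `2` as `UnbiasedProx`, and WarmStart-SVRG from `xinit` with `32 n`
iterations per epoch. -/
def recappSvrg {n d : ℕ} [NeZero n] (X : Set (Euc d)) (f : Fin n → Euc d → ℝ) (L : ℝ)
    (xinit : Euc d) (T : ℕ) : QueryM (Euc d) :=
  recapp X (warmStartSvrg X (gradOracle f) L (32 * n) (warmStartEpochs n) xinit)
    (approxProxSvrg X (gradOracle f) L (L / n)) 2 T

/-- Restarted RECAPP for the finite sum of the `fᵢ`, with the same ingredients. -/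
def restartedRecappSvrg {n d : ℕ} [NeZero n] (X : Set (Euc d)) (f : Fin n → Euc d → ℝ) (L : ℝ)
    (xinit : Euc d) (T K : ℕ) : QueryM (Euc d) :=
  restartedRecapp X (warmStartSvrg X (gradOracle f) L (32 * n) (warmStartEpochs n) xinit)
    (approxProxSvrg X (gradOracle f) L (L / n)) 2 T K

/-- The optimality gap `F(x) - min_X F`. -/
def gap {n d : ℕ} (X : Set (Euc d)) (f : Fin n → Euc d → ℝ) (x : Euc d) : ℝ :=
  objective f x - sInf (objective f '' X)

end Recapp

end

/-! RECAPP is an accelerated proximal point method with inexact prox steps. With `lam = L / n` a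
prox subproblem has condition number of order `n`, so an SVRG epoch of `O(n)` queries reduces its
error by a constant factor, while the outer loop converges as if the smoothness were `lam`: the gap
after `T` iterations is `O((gap x₀ + lam R²) / T²)`. A constant relative error per iteration
suffices, so no logarithmic factor is lost.

Three facts carry the rate. (a) The variance of an SVRG step is bounded by the Bregman divergences
`V_u` of the iterate and of the center relative to the prox point `u`, which yields
`lexp_oneEpochSvrg_le` and then `IsApproxProx`: the error is at most an eighth of `lam/2 ‖xinit -
u‖² + V_u(xprev)`. Both terms occur with a negative sign in the accelerated analysis
(`IsProxPoint.objective_le`), which therefore pays for the error. (b) Unbiasedness and small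
variance of the multilevel estimator are used only through one inequality, `𝔼‖x̃ - p‖² ≤ ‖u - p‖² +
small` for every `p` (`IsApproxProx.lexp_unbiasedProx_le`). The cross terms of consecutive levels
telescope, and the contraction by `1/8` beats the weights `2^(k+1)`; the geometric law keeps the
expected cost at four calls. (c) The potential `α_t⁻² (F(x_t) - min F) + lam/2 ‖v_t - z‖²` does not
increase in expectation (`IsApproxProx.lexp_recappBody_le`), and `α_t⁻¹ ≥ (t + 2)/2`.

The warm start keeps the gap below `L R² n^(2^(-k)) / (2n)` after `k` epochs, so about `log log n`
epochs reach `O(L R² / n)`. Under strong convexity, `O(√(L/(nγ)))` iterations halve the gap, and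
restarting iterates this.

All expectations are sums in `ℝ≥0∞` of nonnegative functions, so integrability never arises; in
exchange every potential must be nonnegative, which holds on `X` only, and so membership in `X` is
tracked through all procedures. -/

noncomputable section

namespace Recapp

/-! ### Expectations under a discrete law -/

theorem tsum_bind_mul {α β : Type} (p : PMF α) (k : α → PMF β) (g : β → ℝ≥0∞) :
    ∑' b, (p.bind k) b * g b = ∑' a, p a * ∑' b, k a b * g b := by
  simp_rw [PMF.bind_apply, ← ENNReal.tsum_mul_right, ← ENNReal.tsum_mul_left]
  rw [ENNReal.tsum_comm]
  simp_rw [mul_assoc]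

theorem tsum_pure_mul {α : Type} (a : α) (g : α → ℝ≥0∞) :
    ∑' b, (PMF.pure a) b * g b = g a := by
  rw [tsum_eq_single a]
  · simp
  · intro b hb
    simp [PMF.pure_apply_of_ne _ _ hb]

theorem tsum_map_mul {α β : Type} (p : PMF α) (h : α → β) (g : β → ℝ≥0∞) :
    ∑' b, (PMF.map h p) b * g b = ∑' a, p a * g (h a) := by
  rw [← PMF.bind_pure_comp, tsum_bind_mul]
  simp only [Function.comp, tsum_pure_mul]

namespace QueryM

variable {α β : Type}

/-- The expectation of an extended nonnegative function of the result. -/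
def lexp (m : QueryM α) (g : α → ℝ≥0∞) : ℝ≥0∞ := ∑' z, m.law z * g z.1

theorem expectation_eq_lexp (m : QueryM α) (g : α → ℝ) :
    m.expectation g = m.lexp fun a => ENNReal.ofReal (g a) := rfl

theorem lexp_pure (a : α) (g : α → ℝ≥0∞) : lexp (pure a) g = g a :=
  tsum_pure_mul (a, 0) fun z : α × ℕ => g z.1

theorem lexp_bind (m : QueryM α) (k : α → QueryM β) (g : β → ℝ≥0∞) :
    lexp (m >>= k) g = lexp m fun a => lexp (k a) g := by
  refine (tsum_bind_mul m.law _ fun z : β × ℕ => g z.1).trans ?_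
  refine tsum_congr fun z => ?_
  rw [tsum_map_mul]
  rfl

theorem lexp_sample (p : PMF α) (g : α → ℝ≥0∞) : lexp (sample p) g = ∑' a, p a * g a :=
  tsum_map_mul p (fun a => (a, 0)) fun z : α × ℕ => g z.1

theorem lexp_add (m : QueryM α) (g h : α → ℝ≥0∞) :
    (lexp m fun a => g a + h a) = lexp m g + lexp m h := by
  simp only [lexp, mul_add, ENNReal.tsum_add]

theorem lexp_const_mul (m : QueryM α) (c : ℝ≥0∞) (g : α → ℝ≥0∞) :
    (lexp m fun a => c * g a) = c * lexp m g := by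
  simp only [lexp, mul_left_comm _ c, ENNReal.tsum_mul_left]

theorem lexp_const (m : QueryM α) (c : ℝ≥0∞) : (lexp m fun _ => c) = c := by
  simp only [lexp, ENNReal.tsum_mul_right, PMF.tsum_coe, one_mul]

/-- Results outside the support carry no mass, so pointwise comparison on `S` is enough. This is
what lets inequalities valid only on `X` pass under the expectation. -/
theorem ResultIn.lexp_mono {m : QueryM α} {S : Set α} (hm : m.ResultIn S) {g h : α → ℝ≥0∞}
    (hgh : ∀ a ∈ S, g a ≤ h a) : lexp m g ≤ lexp m h := by
  refine ENNReal.tsum_le_tsum fun z => ?_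
  by_cases hz : m.law z = 0
  · simp [hz]
  · exact mul_le_mul_right (hgh _ (hm z ((PMF.mem_support_iff _ _).2 hz))) _

theorem ResultIn.lexp_congr {m : QueryM α} {S : Set α} (hm : m.ResultIn S) {g h : α → ℝ≥0∞}
    (hgh : ∀ a ∈ S, g a = h a) : lexp m g = lexp m h :=
  le_antisymm (hm.lexp_mono fun a ha => (hgh a ha).le) (hm.lexp_mono fun a ha => (hgh a ha).ge)

theorem resultIn_univ (m : QueryM α) : m.ResultIn Set.univ := fun _ _ => Set.mem_univ _

theorem lexp_mono (m : QueryM α) {g h : α → ℝ≥0∞} (hgh : ∀ a, g a ≤ h a) :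
    lexp m g ≤ lexp m h :=
  m.resultIn_univ.lexp_mono fun a _ => hgh a

/-- Additivity of the expectation for real functions that are nonnegative on the results. -/
theorem lexp_ofReal_add (m : QueryM α) {S : Set α} (hm : m.ResultIn S) {g h : α → ℝ}
    (hg : ∀ a ∈ S, 0 ≤ g a) (hh : ∀ a ∈ S, 0 ≤ h a) :
    (lexp m fun a => ENNReal.ofReal (g a + h a)) =
      (lexp m fun a => ENNReal.ofReal (g a)) + lexp m fun a => ENNReal.ofReal (h a) := by
  rw [← lexp_add]
  exact hm.lexp_congr fun a ha => ENNReal.ofReal_add (hg a ha) (hh a ha)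

theorem lexp_ofReal_mul (m : QueryM α) {c : ℝ} (hc : 0 ≤ c) (g : α → ℝ) :
    (lexp m fun a => ENNReal.ofReal (c * g a)) =
      ENNReal.ofReal c * lexp m fun a => ENNReal.ofReal (g a) := by
  rw [← lexp_const_mul]
  simp only [ENNReal.ofReal_mul hc]

theorem resultIn_pure {S : Set α} {a : α} (ha : a ∈ S) : (pure a : QueryM α).ResultIn S := by
  intro z hz
  have : z = (a, 0) := (PMF.mem_support_pure_iff _ _).1 hz
  rw [this]
  exact ha

theorem ResultIn.bind {m : QueryM α} {S : Set α} {U : Set β} {k : α → QueryM β}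
    (hm : m.ResultIn S) (hk : ∀ a ∈ S, (k a).ResultIn U) : (m >>= k).ResultIn U := by
  intro z hz
  obtain ⟨y, hy, hyz⟩ := (PMF.mem_support_bind_iff _ _ _).1 hz
  obtain ⟨w, hw, rfl⟩ := (PMF.mem_support_map_iff _ _ _).1 hyz
  exact hk _ (hm y hy) w hw

theorem expectedQueries_pure (a : α) : expectedQueries (pure a : QueryM α) = 0 :=
  (tsum_pure_mul (a, 0) fun z : α × ℕ => (z.2 : ℝ≥0∞)).trans (by simp)

theorem expectedQueries_sample (p : PMF α) : expectedQueries (sample p) = 0 :=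
  (tsum_map_mul p _ fun z : α × ℕ => (z.2 : ℝ≥0∞)).trans (by simp)

theorem expectedQueries_bind (m : QueryM α) (k : α → QueryM β) :
    expectedQueries (m >>= k) = expectedQueries m + lexp m fun a => expectedQueries (k a) := by
  refine (tsum_bind_mul m.law _ fun z : β × ℕ => (z.2 : ℝ≥0∞)).trans ?_
  rw [expectedQueries, lexp, ← ENNReal.tsum_add]
  refine tsum_congr fun z => ?_
  rw [tsum_map_mul, ← mul_add]
  congr 1
  simp only [Nat.cast_add, mul_add, ENNReal.tsum_add, ENNReal.tsum_mul_right, PMF.tsum_coe,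
    one_mul]
  rfl

theorem expectedQueries_bind_le (m : QueryM α) (k : α → QueryM β) {a b : ℝ≥0∞}
    (hm : m.expectedQueries ≤ a) (hk : ∀ x, (k x).expectedQueries ≤ b) :
    expectedQueries (m >>= k) ≤ a + b := by
  rw [expectedQueries_bind]
  exact add_le_add hm ((lexp_mono m hk).trans (lexp_const m b).le)

theorem expectedQueries_forLoop_le (body : ℕ → α → QueryM α) (init : α) (T : ℕ) {b : ℝ≥0∞}
    (h : ∀ t x, (body t x).expectedQueries ≤ b) :
    (forLoop body init T).expectedQueries ≤ T * b := by
  induction T with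
  | zero => simp [forLoop, expectedQueries_pure]
  | succ T ih =>
    rw [Nat.cast_succ, add_mul, one_mul]
    exact expectedQueries_bind_le _ _ ih (h T)

theorem resultIn_forLoop {body : ℕ → α → QueryM α} {init : α} {S : ℕ → Set α}
    (h0 : init ∈ S 0) (h : ∀ t, ∀ x ∈ S t, (body t x).ResultIn (S (t + 1))) (T : ℕ) :
    (forLoop body init T).ResultIn (S T) := by
  induction T with
  | zero => exact resultIn_pure h0
  | succ T ih => exact ih.bind (h T)

theorem lexp_forLoop_succ (body : ℕ → α → QueryM α) (init : α) (T : ℕ) (g : α → ℝ≥0∞) :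
    lexp (forLoop body init (T + 1)) g = lexp (forLoop body init T) fun x => lexp (body T x) g :=
  lexp_bind _ _ _

/-- A potential that grows by at most `b` in expectation in every step of a loop. -/
theorem lexp_forLoop_le {body : ℕ → α → QueryM α} {init : α} {S : ℕ → Set α}
    (h0 : init ∈ S 0) (h : ∀ t, ∀ x ∈ S t, (body t x).ResultIn (S (t + 1)))
    {P : ℕ → α → ℝ≥0∞} {b : ℝ≥0∞}
    (hP : ∀ t, ∀ x ∈ S t, lexp (body t x) (P (t + 1)) ≤ P t x + b) (T : ℕ) :
    lexp (forLoop body init T) (P T) ≤ P 0 init + T * b := by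
  induction T with
  | zero => simp [forLoop, lexp_pure]
  | succ T ih =>
    rw [lexp_forLoop_succ]
    refine ((resultIn_forLoop h0 h T).lexp_mono (hP T)).trans ?_
    rw [lexp_add, lexp_const, Nat.cast_succ, add_mul, one_mul, ← add_assoc]
    gcongr

/-- A potential that is multiplied by at most `ρ` in expectation in every step of a loop. -/
theorem lexp_forLoop_le_pow {body : ℕ → α → QueryM α} {init : α} {S : Set α}
    (h0 : init ∈ S) (h : ∀ t, ∀ x ∈ S, (body t x).ResultIn S)
    {P : α → ℝ≥0∞} {ρ : ℝ≥0∞}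
    (hP : ∀ t, ∀ x ∈ S, lexp (body t x) P ≤ ρ * P x) (T : ℕ) :
    lexp (forLoop body init T) P ≤ ρ ^ T * P init := by
  induction T with
  | zero => simp [forLoop, lexp_pure]
  | succ T ih =>
    rw [lexp_forLoop_succ]
    refine ((resultIn_forLoop (S := fun _ => S) h0 h T).lexp_mono (hP T)).trans ?_
    rw [lexp_const_mul, pow_succ', mul_assoc]
    gcongr

end QueryM

open QueryM

theorem lexp_sample_uniform {n : ℕ} [NeZero n] (g : Fin n → ℝ≥0∞) :
    lexp (sample (PMF.uniformOfFintype (Fin n))) g = (n : ℝ≥0∞)⁻¹ * ∑ i, g i := by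
  rw [lexp_sample, tsum_fintype, Finset.mul_sum]
  simp

/-! ### Deterministic oracles -/

/-- The oracle that returns `h i x` at the cost of one query. -/
def detOracle {n d : ℕ} (h : Fin n → Euc d → Euc d) : Oracle n d :=
  fun i x => (PMF.pure (h i x, 1) : PMF (Euc d × ℕ))

theorem lexp_detOracle {n d : ℕ} (h : Fin n → Euc d → Euc d) (i : Fin n) (x : Euc d)
    (g : Euc d → ℝ≥0∞) : lexp (detOracle h i x) g = g (h i x) :=
  tsum_pure_mul (h i x, 1) fun z : Euc d × ℕ => g z.1

theorem expectedQueries_detOracle {n d : ℕ} (h : Fin n → Euc d → Euc d) (i : Fin n) (x : Euc d) :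
    (detOracle h i x).expectedQueries = 1 :=
  (tsum_pure_mul (h i x, 1) fun z : Euc d × ℕ => (z.2 : ℝ≥0∞)).trans (by simp)

theorem proxOracle_gradOracle {n d : ℕ} (f : Fin n → Euc d → ℝ) (lam : ℝ) (s : Euc d) :
    proxOracle (gradOracle f) lam s =
      detOracle fun i x => gradient (f i) x + lam • (x - s) := by
  funext i x
  refine (PMF.pure_bind _ _).trans ?_
  refine (PMF.pure_map _ _).trans ?_
  rfl

/-- The plain oracle is the regularized one with `lam = 0`, so a single analysis of an SVRG epoch
serves both the prox steps and the warm start. -/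
theorem gradOracle_eq_detOracle {n d : ℕ} (f : Fin n → Euc d → ℝ) (s : Euc d) :
    gradOracle f = detOracle fun i x => gradient (f i) x + (0 : ℝ) • (x - s) := by
  funext i x
  simp only [gradOracle, detOracle, zero_smul, add_zero]
  rfl

theorem foldlM_detOracle {n d : ℕ} (h : Fin n → Euc d → Euc d) (x : Euc d) (l : List (Fin n))
    (a : Euc d) :
    l.foldlM (fun (acc : Euc d) (i : Fin n) => (do
      let g ← detOracle h i x
      pure (acc + g) : QueryM (Euc d))) a =
    (PMF.pure (a + (l.map fun i => h i x).sum, l.length) : PMF (Euc d × ℕ)) := by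
  induction l generalizing a with
  | nil => simp; rfl
  | cons i l ih =>
    rw [List.foldlM_cons]
    have h1 : (detOracle h i x >>= fun g => (pure (a + g) : QueryM (Euc d))) =
        (PMF.pure (a + h i x, 1) : PMF (Euc d × ℕ)) := by
      refine (PMF.pure_bind _ _).trans ?_
      refine (PMF.pure_map _ _).trans ?_
      rfl
    rw [h1]
    refine (PMF.pure_bind _ _).trans ?_
    simp only [ih]
    refine (PMF.pure_map _ _).trans ?_
    simp only [List.map_cons, List.sum_cons, List.length_cons, add_assoc]
    rw [add_comm 1]

theorem fullGradient_detOracle {n d : ℕ} (h : Fin n → Euc d → Euc d) (x : Euc d) :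
    fullGradient (detOracle h) x =
      (PMF.pure ((n : ℝ)⁻¹ • ∑ i, h i x, n) : PMF (Euc d × ℕ)) := by
  rw [fullGradient, foldlM_detOracle]
  refine (PMF.pure_bind _ _).trans ?_
  refine (PMF.pure_map _ _).trans ?_
  simp [List.sum_ofFn, ← List.ofFn_eq_map]

theorem lexp_fullGradient {n d : ℕ} (h : Fin n → Euc d → Euc d) (x : Euc d)
    (g : Euc d → ℝ≥0∞) :
    lexp (fullGradient (detOracle h) x) g = g ((n : ℝ)⁻¹ • ∑ i, h i x) := by
  rw [fullGradient_detOracle]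
  exact tsum_pure_mul _ fun z : Euc d × ℕ => g z.1

theorem expectedQueries_fullGradient {n d : ℕ} (h : Fin n → Euc d → Euc d) (x : Euc d) :
    (fullGradient (detOracle h) x).expectedQueries = n := by
  rw [fullGradient_detOracle]
  exact tsum_pure_mul _ fun z : Euc d × ℕ => (z.2 : ℝ≥0∞)

/-! ### Convex and smooth functions -/

section ConvexAnalysis

variable {n d : ℕ}

theorem hasDerivAt_comp_line {f : Euc d → ℝ} (hf : Differentiable ℝ f) (x v : Euc d) (t : ℝ) :
    HasDerivAt (fun t : ℝ => f (x + t • v)) (inner ℝ (gradient f (x + t • v)) v) t := by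
  have h1 : HasDerivAt (fun t : ℝ => x + t • v) v t := by
    simpa using ((hasDerivAt_id t).smul_const v).const_add x
  have h2 := (hf (x + t • v)).hasFDerivAt.comp_hasDerivAt t h1
  rwa [inner_gradient_left]

theorem add_inner_gradient_le {f : Euc d → ℝ} (hc : ConvexOn ℝ Set.univ f)
    (hf : Differentiable ℝ f) (x y : Euc d) :
    f x + inner ℝ (gradient f x) (y - x) ≤ f y := by
  have h1 : ConvexOn ℝ Set.univ (fun t : ℝ => f (x + t • (y - x))) := by
    have := hc.comp_affineMap (AffineMap.lineMap (k := ℝ) x y)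
    refine (this.congr fun t _ => ?_)
    simp [AffineMap.lineMap_apply_module', add_comm]
  have h2 := h1.le_slope_of_hasDerivAt (Set.mem_univ 0) (Set.mem_univ 1) zero_lt_one
    (hasDerivAt_comp_line hf x (y - x) 0)
  simp [slope_def_field, -inner_gradient_left] at h2
  linarith

/-- Descent lemma: along the segment, `f` minus its linear and quadratic model has nonpositive
derivative by Cauchy–Schwarz and the Lipschitz bound. -/
theorem le_add_inner_gradient {f : Euc d → ℝ} {L : ℝ} (hf : Differentiable ℝ f)
    (hL : ∀ x y, ‖gradient f x - gradient f y‖ ≤ L * ‖x - y‖) (x y : Euc d) :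
    f y ≤ f x + inner ℝ (gradient f x) (y - x) + L / 2 * ‖y - x‖ ^ 2 := by
  set v := y - x with hv
  have hd : ∀ t : ℝ, HasDerivAt
      (fun t : ℝ => f (x + t • v) - t * inner ℝ (gradient f x) v - L / 2 * ‖v‖ ^ 2 * t ^ 2)
      (inner ℝ (gradient f (x + t • v)) v - inner ℝ (gradient f x) v - L * ‖v‖ ^ 2 * t) t := by
    intro t
    have h1 := ((hasDerivAt_comp_line hf x v t).sub
      ((hasDerivAt_id t).mul_const (inner ℝ (gradient f x) v))).sub
      ((hasDerivAt_pow 2 t).const_mul (L / 2 * ‖v‖ ^ 2))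
    refine h1.congr_deriv ?_
    simp
    ring
  have ha : AntitoneOn
      (fun t : ℝ => f (x + t • v) - t * inner ℝ (gradient f x) v - L / 2 * ‖v‖ ^ 2 * t ^ 2)
      (Set.Icc 0 1) := by
    refine antitoneOn_of_deriv_nonpos (convex_Icc 0 1)
      (fun t _ => (hd t).continuousAt.continuousWithinAt)
      (fun t _ => (hd t).differentiableAt.differentiableWithinAt) fun t ht => ?_
    rw [interior_Icc] at ht
    rw [(hd t).deriv, ← inner_sub_left]
    have h2 := real_inner_le_norm (gradient f (x + t • v) - gradient f x) v
    have h3 := hL (x + t • v) x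
    rw [add_sub_cancel_left, norm_smul, Real.norm_of_nonneg ht.1.le] at h3
    have h4 := mul_le_mul_of_nonneg_right h3 (norm_nonneg v)
    nlinarith
  have := ha (Set.left_mem_Icc.2 zero_le_one) (Set.right_mem_Icc.2 zero_le_one) zero_le_one
  simp [hv, -inner_gradient_left] at this
  rw [hv]
  linarith

/-- The Bregman divergence `V_u(x) = f(x) - f(u) - ⟨∇ f(u), x - u⟩`. -/
def bregman (f : Euc d → ℝ) (u x : Euc d) : ℝ := f x - f u - inner ℝ (gradient f u) (x - u)

/-- At the gradient-step point `x - L⁻¹ (∇f(x) - ∇f(u))` the tangent of `f` at `u` is a lower bound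
and the quadratic model at `x` an upper bound; comparing the two gives the claim. -/
theorem norm_gradient_sub_sq_le {f : Euc d → ℝ} {L : ℝ} (hL0 : 0 < L)
    (hc : ConvexOn ℝ Set.univ f) (hf : Differentiable ℝ f)
    (hL : ∀ x y, ‖gradient f x - gradient f y‖ ≤ L * ‖x - y‖) (u x : Euc d) :
    ‖gradient f x - gradient f u‖ ^ 2 ≤ 2 * L * bregman f u x := by
  set g := gradient f x - gradient f u with hg
  have h1 := add_inner_gradient_le hc hf u (x - L⁻¹ • g)
  have h2 := le_add_inner_gradient hf hL x (x - L⁻¹ • g)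
  have e1 : x - L⁻¹ • g - x = -(L⁻¹ • g) := by abel
  have e2 : x - L⁻¹ • g - u = (x - u) - L⁻¹ • g := by abel
  rw [e1, norm_neg, norm_smul, inner_neg_right, inner_smul_right, mul_pow,
    Real.norm_of_nonneg (inv_nonneg.2 hL0.le)] at h2
  rw [e2, inner_sub_right, inner_smul_right] at h1
  have h3 : inner ℝ (gradient f x) g - inner ℝ (gradient f u) g = ‖g‖ ^ 2 := by
    rw [← inner_sub_left, ← hg, real_inner_self_eq_norm_sq]
  have h4 : L / 2 * (L⁻¹ ^ 2 * ‖g‖ ^ 2) = L⁻¹ / 2 * ‖g‖ ^ 2 := by field_simp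
  have h5 : L⁻¹ / 2 * ‖g‖ ^ 2 ≤ bregman f u x := by
    rw [bregman]
    rw [h4] at h2
    have : L⁻¹ * inner ℝ (gradient f x) g - L⁻¹ * inner ℝ (gradient f u) g = L⁻¹ * ‖g‖ ^ 2 := by
      rw [← h3]; ring
    linarith
  calc ‖g‖ ^ 2 = 2 * L * (L⁻¹ / 2 * ‖g‖ ^ 2) := by field_simp
    _ ≤ _ := by gcongr

/-- The gradient of the objective. -/
def gradObj (f : Fin n → Euc d → ℝ) (x : Euc d) : Euc d := (n : ℝ)⁻¹ • ∑ i, gradient (f i) x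

/-- The Bregman divergence of the objective. -/
def bregObj (f : Fin n → Euc d → ℝ) (u x : Euc d) : ℝ :=
  objective f x - objective f u - inner ℝ (gradObj f u) (x - u)

theorem bregObj_eq (f : Fin n → Euc d → ℝ) (u x : Euc d) :
    bregObj f u x = (n : ℝ)⁻¹ * ∑ i, bregman (f i) u x := by
  simp only [bregObj, bregman, objective, gradObj, inner_smul_left, sum_inner,
    Finset.sum_sub_distrib]
  simp
  ring

theorem inv_mul_sum_const [NeZero n] (c : ℝ) : (n : ℝ)⁻¹ * ∑ _i : Fin n, c = c := by
  have : (n : ℝ) ≠ 0 := NeZero.ne _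
  simp [this]

theorem inv_mul_sum_le_inv_mul_sum {a b : Fin n → ℝ} (h : ∀ i, a i ≤ b i) :
    (n : ℝ)⁻¹ * ∑ i, a i ≤ (n : ℝ)⁻¹ * ∑ i, b i := by
  gcongr with i
  exact h i

theorem hasGradientAt_objective {f : Fin n → Euc d → ℝ} (hf : ∀ i, Differentiable ℝ (f i))
    (x : Euc d) : HasGradientAt (objective f) (gradObj f x) x := by
  have h1 : HasFDerivAt (fun y => ∑ i, f i y) (∑ i, fderiv ℝ (f i) x) x :=
    HasFDerivAt.fun_sum fun i _ => (hf i x).hasFDerivAt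
  have h2 := h1.const_mul (n : ℝ)⁻¹
  rw [hasGradientAt_iff_hasFDerivAt]
  refine h2.congr_fderiv ?_
  simp [gradObj, toDual_gradient]

theorem differentiable_objective {f : Fin n → Euc d → ℝ} (hf : ∀ i, Differentiable ℝ (f i)) :
    Differentiable ℝ (objective f) := fun x => (hasGradientAt_objective hf x).differentiableAt

theorem convexOn_objective {f : Fin n → Euc d → ℝ} (hf : ∀ i, ConvexOn ℝ Set.univ (f i)) :
    ConvexOn ℝ Set.univ (objective f) := by
  refine ⟨convex_univ, fun x _ y _ a b ha hb hab => ?_⟩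
  simp only [objective, smul_eq_mul]
  calc _ ≤ (n : ℝ)⁻¹ * ∑ i, (a * f i x + b * f i y) :=
        inv_mul_sum_le_inv_mul_sum fun i => (hf i).2 trivial trivial ha hb hab
    _ = _ := by
        rw [Finset.sum_add_distrib, ← Finset.mul_sum, ← Finset.mul_sum]
        ring

/-- The value of the regularized objective relative to its value at `u`. -/
def proxGap (f : Fin n → Euc d → ℝ) (lam : ℝ) (s u x : Euc d) : ℝ :=
  objective f x + lam / 2 * ‖x - s‖ ^ 2 - (objective f u + lam / 2 * ‖u - s‖ ^ 2)

/-- First-order optimality of `u` for the objective plus `(lam / 2) ‖x - s‖²` over `X`. -/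
def IsProxPoint (X : Set (Euc d)) (f : Fin n → Euc d → ℝ) (lam : ℝ) (s u : Euc d) : Prop :=
  u ∈ X ∧ ∀ x ∈ X, 0 ≤ inner ℝ (gradObj f u + lam • (u - s)) (x - u)

theorem norm_sub_sq_expand (x u s : Euc d) :
    ‖x - s‖ ^ 2 = ‖u - s‖ ^ 2 + 2 * inner ℝ (u - s) (x - u) + ‖x - u‖ ^ 2 := by
  have : x - s = (u - s) + (x - u) := by abel
  rw [this, norm_add_sq_real]

theorem proxGap_eq (f : Fin n → Euc d → ℝ) (lam : ℝ) (s u x : Euc d) :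
    proxGap f lam s u x = inner ℝ (gradObj f u + lam • (u - s)) (x - u) + bregObj f u x +
      lam / 2 * ‖x - u‖ ^ 2 := by
  rw [proxGap, bregObj, norm_sub_sq_expand x u s, inner_add_left, real_inner_smul_left]
  ring

/-- The optimality condition says exactly that the linear term in `proxGap_eq` is nonnegative on
`X`. -/
theorem IsProxPoint.bregObj_add_le {X : Set (Euc d)} {f : Fin n → Euc d → ℝ} {lam : ℝ}
    {s u x : Euc d} (hu : IsProxPoint X f lam s u) (hx : x ∈ X) :
    bregObj f u x + lam / 2 * ‖x - u‖ ^ 2 ≤ proxGap f lam s u x := by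
  rw [proxGap_eq]
  linarith [hu.2 x hx]

namespace IsFiniteSumProblem

variable {X : Set (Euc d)} {f : Fin n → Euc d → ℝ} {L R : ℝ}

theorem bregObj_nonneg (H : IsFiniteSumProblem X f L R) (u x : Euc d) : 0 ≤ bregObj f u x := by
  rw [bregObj_eq]
  refine mul_nonneg (by positivity) (Finset.sum_nonneg fun i _ => ?_)
  have := add_inner_gradient_le (H.convexOn i) (H.differentiable i) u x
  rw [bregman]
  linarith

theorem bregObj_le [NeZero n] (H : IsFiniteSumProblem X f L R) (u x : Euc d) :
    bregObj f u x ≤ L / 2 * ‖x - u‖ ^ 2 := by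
  rw [bregObj_eq, ← inv_mul_sum_const (n := n) (L / 2 * ‖x - u‖ ^ 2)]
  refine inv_mul_sum_le_inv_mul_sum fun i => ?_
  have := le_add_inner_gradient (H.differentiable i) (H.smooth i) u x
  rw [bregman]
  linarith

theorem sum_norm_gradient_sub_sq_le (H : IsFiniteSumProblem X f L R) (hL : 0 < L) (u x : Euc d) :
    (n : ℝ)⁻¹ * ∑ i, ‖gradient (f i) x - gradient (f i) u‖ ^ 2 ≤ 2 * L * bregObj f u x := by
  rw [bregObj_eq, mul_left_comm (2 * L), Finset.mul_sum Finset.univ _ (2 * L)]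
  exact inv_mul_sum_le_inv_mul_sum fun i =>
    norm_gradient_sub_sq_le hL (H.convexOn i) (H.differentiable i) (H.smooth i) u x

theorem continuous_objective (H : IsFiniteSumProblem X f L R) : Continuous (objective f) :=
  (differentiable_objective H.differentiable).continuous

theorem isCompact (H : IsFiniteSumProblem X f L R) : IsCompact X := by
  refine Metric.isCompact_of_isClosed_isBounded H.isClosed ?_
  refine Metric.isBounded_iff.2 ⟨R, fun x hx y hy => ?_⟩
  rw [dist_eq_norm]
  exact H.diam_le x hx y hy

/-- A minimizer exists by compactness, and its derivative is nonnegative along feasible directions.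
Any sign of `lam` is allowed; `lam = 0` supplies the minimizer of the objective itself, and
uniqueness plays no role. -/
theorem exists_isProxPoint (H : IsFiniteSumProblem X f L R) (hX : X.Nonempty) (lam : ℝ)
    (s : Euc d) : ∃ u, IsProxPoint X f lam s u := by
  have hc : Continuous fun x => objective f x + lam / 2 * ‖x - s‖ ^ 2 := by
    have := H.continuous_objective
    fun_prop
  obtain ⟨u, hu, hmin⟩ := H.isCompact.exists_isMinOn hX hc.continuousOn
  refine ⟨u, hu, fun x hx => ?_⟩
  have hd1 := (hasGradientAt_objective H.differentiable u)
  rw [hasGradientAt_iff_hasFDerivAt] at hd1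
  have hd2 : HasFDerivAt (fun x : Euc d => lam / 2 * ‖x - s‖ ^ 2)
      ((lam / 2) • (2 • (innerSL ℝ (u - s)).comp (ContinuousLinearMap.id ℝ (Euc d)))) u :=
    (((hasFDerivAt_id u).sub_const s).norm_sq).const_mul _
  have h := hmin.localize.hasFDerivWithinAt_nonneg (hd1.add hd2).hasFDerivWithinAt
    (sub_mem_posTangentConeAt_of_segment_subset (H.convex.segment_subset hu hx))
  simp at h
  rw [inner_add_left, real_inner_smul_left, inner_sub_left]
  linarith

theorem objective_le_of_isProxPoint (H : IsFiniteSumProblem X f L R) {s z x : Euc d}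
    (hz : IsProxPoint X f 0 s z) (hx : x ∈ X) : objective f z ≤ objective f x := by
  have := hz.bregObj_add_le hx
  rw [proxGap] at this
  linarith [H.bregObj_nonneg z x]

theorem gap_eq (H : IsFiniteSumProblem X f L R) {s z : Euc d} (hz : IsProxPoint X f 0 s z)
    (x : Euc d) : gap X f x = objective f x - objective f z := by
  have : IsLeast (objective f '' X) (objective f z) :=
    ⟨Set.mem_image_of_mem _ hz.1, by
      rintro _ ⟨y, hy, rfl⟩
      exact H.objective_le_of_isProxPoint hz hy⟩
  rw [gap, this.csInf_eq]

theorem gap_nonneg (H : IsFiniteSumProblem X f L R) {x : Euc d} (hx : x ∈ X) :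
    0 ≤ gap X f x := by
  obtain ⟨z, hz⟩ := H.exists_isProxPoint ⟨x, hx⟩ 0 0
  rw [H.gap_eq hz]
  linarith [H.objective_le_of_isProxPoint hz hx]

/-- Quadratic growth: a point of the segment at weight `t` on `x` has value at least the minimum;
dividing the strong convexity inequality by `t` and letting `t → 0` leaves the full factor `γ/2`. -/
theorem sq_dist_le_gap (H : IsFiniteSumProblem X f L R) {γ : ℝ}
    (hγ : StrongConvexOn X γ (objective f)) {s z x : Euc d} (hz : IsProxPoint X f 0 s z)
    (hx : x ∈ X) : γ / 2 * ‖x - z‖ ^ 2 ≤ gap X f x := by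
  rw [H.gap_eq hz]
  have key : ∀ t : ℝ, 0 < t → t < 1 →
      (1 - t) * (γ / 2 * ‖x - z‖ ^ 2) ≤ objective f x - objective f z := by
    intro t ht ht1
    have h1 := hγ.2 hx hz.1 ht.le (sub_nonneg.2 ht1.le) (by ring)
    have h2 := H.objective_le_of_isProxPoint hz
      (H.convex hx hz.1 ht.le (sub_nonneg.2 ht1.le) (by ring))
    simp only [smul_eq_mul] at h1
    have h3 : t * ((1 - t) * (γ / 2 * ‖x - z‖ ^ 2)) ≤ t * (objective f x - objective f z) := by
      linarith
    exact le_of_mul_le_mul_left h3 ht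
  have hlim : Filter.Tendsto (fun t : ℝ => (1 - t) * (γ / 2 * ‖x - z‖ ^ 2))
      (nhdsWithin 0 (Set.Ioi 0)) (nhds ((1 - 0) * (γ / 2 * ‖x - z‖ ^ 2))) :=
    (Continuous.tendsto (by fun_prop) _).mono_left nhdsWithin_le_nhds
  rw [sub_zero, one_mul] at hlim
  refine le_of_tendsto hlim ?_
  filter_upwards [Ioo_mem_nhdsGT (zero_lt_one' ℝ)] with t ht
  exact key t ht.1 ht.2

end IsFiniteSumProblem

/-! ### Projections -/

section Projection

variable {X : Set (Euc d)}

theorem proj_spec (hX : X.Nonempty) (hc : IsClosed X) (hv : Convex ℝ X) (x : Euc d) :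
    proj X x ∈ X ∧ ∀ z ∈ X, inner ℝ (x - proj X x) (z - proj X x) ≤ 0 := by
  have hex : ∃ y ∈ X, ∀ z ∈ X, ‖x - y‖ ≤ ‖x - z‖ := by
    obtain ⟨y, hy, hd⟩ := hc.exists_infDist_eq_dist hX x
    refine ⟨y, hy, fun z hz => ?_⟩
    rw [← dist_eq_norm, ← dist_eq_norm, ← hd]
    exact Metric.infDist_le_dist_of_mem hz
  have hp : proj X x = hex.choose := by
    unfold proj
    rw [dif_pos hex]
  rw [hp]
  obtain ⟨h1, h2⟩ := hex.choose_spec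
  refine ⟨h1, (norm_eq_iInf_iff_real_inner_le_zero hv h1).1 ?_⟩
  have : Nonempty X := hX.to_subtype
  refine le_antisymm (le_ciInf fun z => h2 z z.2) (ciInf_le ⟨0, ?_⟩ (⟨_, h1⟩ : X))
  rintro _ ⟨z, rfl⟩
  positivity

theorem norm_proj_sub_sq_le (hX : X.Nonempty) (hc : IsClosed X) (hv : Convex ℝ X) (x : Euc d)
    {z : Euc d} (hz : z ∈ X) : ‖proj X x - z‖ ^ 2 ≤ ‖x - z‖ ^ 2 := by
  have h := (proj_spec hX hc hv x).2 z hz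
  have e := norm_sub_sq_expand x (proj X x) z
  have e2 : inner ℝ (proj X x - z) (x - proj X x) =
      - inner ℝ (x - proj X x) (z - proj X x) := by
    rw [real_inner_comm, ← inner_neg_right, neg_sub]
  rw [e2] at e
  nlinarith [sq_nonneg ‖x - proj X x‖]

end Projection

end ConvexAnalysis

/-! ### One epoch of SVRG -/

variable {n d : ℕ} {X : Set (Euc d)} {f : Fin n → Euc d → ℝ} {L R : ℝ}

theorem inv_mul_sum_ofReal [NeZero n] {a : Fin n → ℝ} (ha : ∀ i, 0 ≤ a i) :
    (n : ℝ≥0∞)⁻¹ * ∑ i, ENNReal.ofReal (a i) = ENNReal.ofReal ((n : ℝ)⁻¹ * ∑ i, a i) := by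
  have hn : (0 : ℝ) < n := Nat.cast_pos.2 (NeZero.pos n)
  rw [ENNReal.ofReal_mul (by positivity), ENNReal.ofReal_sum_of_nonneg fun i _ => ha i,
    ENNReal.ofReal_inv_of_pos hn, ENNReal.ofReal_natCast]

theorem inner_le_young (a b : Euc d) {θ : ℝ} (hθ : 0 < θ) :
    inner ℝ a b ≤ θ * ‖b‖ ^ 2 + (4 * θ)⁻¹ * ‖a‖ ^ 2 := by
  have h := norm_sub_sq_real a ((2 * θ) • b)
  rw [inner_smul_right, norm_smul, Real.norm_of_nonneg (by positivity)] at h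
  have h1 : 0 ≤ (4 * θ)⁻¹ * (‖a‖ ^ 2 - 2 * (2 * θ * inner ℝ a b) + (2 * θ * ‖b‖) ^ 2) := by
    rw [← h]; positivity
  have h2 : (4 * θ)⁻¹ * (‖a‖ ^ 2 - 2 * (2 * θ * inner ℝ a b) + (2 * θ * ‖b‖) ^ 2) =
      (4 * θ)⁻¹ * ‖a‖ ^ 2 - inner ℝ a b + θ * ‖b‖ ^ 2 := by
    field_simp
    ring
  linarith

/-- Progress of one projected step along an inexact gradient `g`. -/
theorem proxGap_projected_step_le [NeZero n] (H : IsFiniteSumProblem X f L R) {lam η : ℝ}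
    (hlam : 0 ≤ lam) (hη : 0 < η) (hηL : η * (L + lam) ≤ 1 / 8) {u x s g : Euc d}
    (hu : u ∈ X) :
    proxGap f lam s u (proj X (x - η • g)) + (2 * η)⁻¹ * ‖proj X (x - η • g) - u‖ ^ 2 ≤
      (2 * η)⁻¹ * ‖x - u‖ ^ 2 + inner ℝ (gradObj f x + lam • (x - s) - g) (x - u) +
        4 * η / 7 * ‖gradObj f x + lam • (x - s) - g‖ ^ 2 := by
  have hp := (proj_spec ⟨u, hu⟩ H.isClosed H.convex (x - η • g)).2 u hu
  set y := proj X (x - η • g) with hy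
  set G := gradObj f x + lam • (x - s) with hG
  have h1 := H.bregObj_le x y
  have h2 := H.bregObj_nonneg x u
  -- Convexity compares the values at `u` and `x`, smoothness those at `x` and `y`; the quadratic
  -- regularizer is expanded exactly and adds `lam` to the curvature.
  have hΨ : proxGap f lam s u y ≤ inner ℝ G (y - u) + (L + lam) / 2 * ‖y - x‖ ^ 2 := by
    have e1 := norm_sub_sq_expand y x s
    have e2 := norm_sub_sq_expand u x s
    have e3 : inner ℝ G (y - u) = inner ℝ (gradObj f x) (y - x) - inner ℝ (gradObj f x) (u - x) +
        lam * (inner ℝ (x - s) (y - x) - inner ℝ (x - s) (u - x)) := by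
      rw [← inner_sub_right, ← inner_sub_right, sub_sub_sub_cancel_right, hG, inner_add_left,
        real_inner_smul_left]
    have h3 : 0 ≤ lam * ‖u - x‖ ^ 2 := by positivity
    rw [proxGap, e1, e2, e3]
    simp only [bregObj] at h1 h2
    linarith
  have hproj : inner ℝ g (y - u) ≤
      (2 * η)⁻¹ * (‖x - u‖ ^ 2 - ‖y - u‖ ^ 2 - ‖y - x‖ ^ 2) := by
    have e : inner ℝ (x - η • g - y) (u - y) =
        η * inner ℝ g (y - u) - inner ℝ (x - y) (y - u) := by
      have : u - y = -(y - u) := by abel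
      rw [this, inner_neg_right, sub_right_comm, inner_sub_left, real_inner_smul_left]
      ring
    have e2 : ‖x - u‖ ^ 2 = ‖y - u‖ ^ 2 + 2 * inner ℝ (x - y) (y - u) + ‖y - x‖ ^ 2 := by
      rw [norm_sub_sq_expand x y u, norm_sub_rev x y, real_inner_comm]
    have e3 : (2 * η)⁻¹ * (‖x - u‖ ^ 2 - ‖y - u‖ ^ 2 - ‖y - x‖ ^ 2) =
        η⁻¹ * inner ℝ (x - y) (y - u) := by
      rw [e2, mul_inv]; ring
    rw [e3, le_inv_mul_iff₀ hη]
    linarith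
  -- The weight `7 / (16 η)` is what remains of the proximal term `1 / (2 η)` once the curvature `(L
  -- + lam)/2 ≤ 1 / (16 η)` has been absorbed.
  have hY := inner_le_young (G - g) (y - x) (θ := 7 / (16 * η)) (by positivity)
  have e4 : (4 * (7 / (16 * η)))⁻¹ = 4 * η / 7 := by field_simp; norm_num
  rw [e4] at hY
  have e5 : inner ℝ G (y - u) =
      inner ℝ g (y - u) + inner ℝ (G - g) (x - u) + inner ℝ (G - g) (y - x) := by
    rw [add_assoc, ← inner_add_right, inner_sub_left]
    have : x - u + (y - x) = y - u := by abel
    rw [this]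
    ring
  have hc : (L + lam) / 2 + 7 / (16 * η) ≤ (2 * η)⁻¹ := by
    rw [div_add_div _ _ (by norm_num) (by positivity), ← one_div, div_le_div_iff₀ (by positivity)
      (by positivity)]
    nlinarith
  have h6 := mul_le_mul_of_nonneg_right hc (sq_nonneg ‖y - x‖)
  linarith

/-- The variance is at most the second moment. -/
theorem inv_mul_sum_norm_mean_sub_sq_le [NeZero n] (a : Fin n → Euc d) :
    (n : ℝ)⁻¹ * ∑ i, ‖(n : ℝ)⁻¹ • ∑ j, a j - a i‖ ^ 2 ≤ (n : ℝ)⁻¹ * ∑ i, ‖a i‖ ^ 2 := by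
  set m := (n : ℝ)⁻¹ • ∑ j, a j with hm
  have hn : (n : ℝ) ≠ 0 := NeZero.ne _
  have hs : ∑ j, a j = (n : ℝ) • m := by rw [hm, smul_inv_smul₀ hn]
  have h1 : ∑ i, ‖m - a i‖ ^ 2 = ∑ i, ‖a i‖ ^ 2 - n * ‖m‖ ^ 2 := by
    simp only [norm_sub_sq_real, Finset.sum_add_distrib, Finset.sum_sub_distrib, ← Finset.mul_sum,
      ← inner_sum, hs, inner_smul_right, real_inner_self_eq_norm_sq]
    simp
    ring
  rw [h1]
  gcongr
  have : 0 ≤ n * ‖m‖ ^ 2 := by positivity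
  linarith

/-- The component gradients of the regularized objective. -/
def regGrad (f : Fin n → Euc d → ℝ) (lam : ℝ) (s : Euc d) (i : Fin n) (x : Euc d) : Euc d :=
  gradient (f i) x + lam • (x - s)

theorem inv_smul_sum_regGrad [NeZero n] (f : Fin n → Euc d → ℝ) (lam : ℝ) (s x : Euc d) :
    (n : ℝ)⁻¹ • ∑ i, regGrad f lam s i x = gradObj f x + lam • (x - s) := by
  have hn : (n : ℝ) ≠ 0 := NeZero.ne _
  simp only [regGrad, Finset.sum_add_distrib, smul_add, gradObj]
  simp [← Nat.cast_smul_eq_nsmul ℝ, smul_smul, hn]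

/-- The variance-reduced gradient estimate at `x` with center `y`. -/
def svrgGrad (f : Fin n → Euc d → ℝ) (lam : ℝ) (s y x : Euc d) (i : Fin n) : Euc d :=
  regGrad f lam s i x - regGrad f lam s i y + (n : ℝ)⁻¹ • ∑ j, regGrad f lam s j y

/-- The regularizer is common to all components and cancels from the noise, so the variance involves
`L` alone and not `L + lam`. -/
theorem grad_sub_svrgGrad [NeZero n] (f : Fin n → Euc d → ℝ) (lam : ℝ) (s y x : Euc d)
    (i : Fin n) :
    gradObj f x + lam • (x - s) - svrgGrad f lam s y x i =
      (n : ℝ)⁻¹ • ∑ j, (gradient (f j) x - gradient (f j) y) -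
        (gradient (f i) x - gradient (f i) y) := by
  rw [svrgGrad, inv_smul_sum_regGrad, Finset.sum_sub_distrib, smul_sub]
  simp only [regGrad, gradObj, smul_sub]
  abel

theorem inv_mul_sum_inner_grad_sub_svrgGrad [NeZero n] (f : Fin n → Euc d → ℝ) (lam : ℝ)
    (s y x w : Euc d) :
    (n : ℝ)⁻¹ * ∑ i, inner ℝ (gradObj f x + lam • (x - s) - svrgGrad f lam s y x i) w = 0 := by
  have hn : (n : ℝ) ≠ 0 := NeZero.ne _
  simp only [grad_sub_svrgGrad]
  rw [← sum_inner, Finset.sum_sub_distrib, Finset.sum_const, Finset.card_univ, Fintype.card_fin,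
    ← Nat.cast_smul_eq_nsmul ℝ, smul_inv_smul₀ hn, sub_self, inner_zero_left, mul_zero]

theorem IsFiniteSumProblem.variance_svrgGrad_le [NeZero n] (H : IsFiniteSumProblem X f L R)
    (hL : 0 < L) (lam : ℝ) (s y x u : Euc d) :
    (n : ℝ)⁻¹ * ∑ i, ‖gradObj f x + lam • (x - s) - svrgGrad f lam s y x i‖ ^ 2 ≤
      4 * L * (bregObj f u x + bregObj f u y) := by
  simp only [grad_sub_svrgGrad]
  refine (inv_mul_sum_norm_mean_sub_sq_le _).trans ?_
  have h1 := H.sum_norm_gradient_sub_sq_le hL u x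
  have h2 := H.sum_norm_gradient_sub_sq_le hL u y
  calc (n : ℝ)⁻¹ * ∑ i, ‖gradient (f i) x - gradient (f i) y‖ ^ 2
      ≤ (n : ℝ)⁻¹ * ∑ i, (2 * ‖gradient (f i) x - gradient (f i) u‖ ^ 2 +
          2 * ‖gradient (f i) y - gradient (f i) u‖ ^ 2) := by
        refine inv_mul_sum_le_inv_mul_sum fun i => ?_
        have e : gradient (f i) x - gradient (f i) y =
          (gradient (f i) x - gradient (f i) u) - (gradient (f i) y - gradient (f i) u) := by abel
        have := parallelogram_law_with_norm ℝ (gradient (f i) x - gradient (f i) u)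
          (gradient (f i) y - gradient (f i) u)
        rw [e]
        nlinarith [sq_nonneg ‖gradient (f i) x - gradient (f i) u +
          (gradient (f i) y - gradient (f i) u)‖]
    _ = 2 * ((n : ℝ)⁻¹ * ∑ i, ‖gradient (f i) x - gradient (f i) u‖ ^ 2) +
          2 * ((n : ℝ)⁻¹ * ∑ i, ‖gradient (f i) y - gradient (f i) u‖ ^ 2) := by
        rw [Finset.sum_add_distrib, ← Finset.mul_sum, ← Finset.mul_sum]
        ring
    _ ≤ _ := by linarith

/-- On averaging over the component the inner product with the noise vanishes, because `x - u` does
not depend on the draw; the factor `4η/7` times the variance bound `4L` gives `16/7 (η L)`. -/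
theorem IsFiniteSumProblem.svrg_step_le [NeZero n] (H : IsFiniteSumProblem X f L R) (hL : 0 < L)
    {lam η : ℝ} (hlam : 0 ≤ lam) (hη : 0 < η) (hηL : η * (L + lam) ≤ 1 / 8) {u s : Euc d}
    (hu : u ∈ X) (x y : Euc d) :
    (n : ℝ)⁻¹ * ∑ i, (proxGap f lam s u (proj X (x - η • svrgGrad f lam s y x i)) +
        (2 * η)⁻¹ * ‖proj X (x - η • svrgGrad f lam s y x i) - u‖ ^ 2) ≤
      (2 * η)⁻¹ * ‖x - u‖ ^ 2 + 16 / 7 * (η * L) * (bregObj f u x + bregObj f u y) := by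
  refine (inv_mul_sum_le_inv_mul_sum fun i =>
    proxGap_projected_step_le H hlam hη hηL (g := svrgGrad f lam s y x i) hu).trans ?_
  rw [Finset.sum_add_distrib, Finset.sum_add_distrib, mul_add, mul_add, inv_mul_sum_const,
    inv_mul_sum_inner_grad_sub_svrgGrad, add_zero, ← Finset.mul_sum]
  have h := mul_le_mul_of_nonneg_left (H.variance_svrgGrad_le hL lam s y x u)
    (show 0 ≤ 4 * η / 7 by positivity)
  linarith

theorem norm_combo_sq_le (p q : Euc d) {a b : ℝ} (ha : 0 ≤ a) (hb : 0 ≤ b) (hab : a + b = 1) :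
    ‖a • p + b • q‖ ^ 2 ≤ a * ‖p‖ ^ 2 + b * ‖q‖ ^ 2 := by
  have h1 := norm_add_sq_real (a • p) (b • q)
  have h2 := norm_sub_sq_real p q
  rw [inner_smul_left, inner_smul_right, norm_smul, norm_smul, Real.norm_of_nonneg ha,
    Real.norm_of_nonneg hb] at h1
  simp only [conj_trivial] at h1
  have h3 : 0 ≤ a * b * ‖p - q‖ ^ 2 := by positivity
  obtain rfl : b = 1 - a := by linarith
  rw [h1]
  rw [h2] at h3
  nlinarith

theorem IsFiniteSumProblem.convexOn_proxGap (H : IsFiniteSumProblem X f L R) {lam : ℝ}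
    (hlam : 0 ≤ lam) (s u : Euc d) : ConvexOn ℝ Set.univ (proxGap f lam s u) := by
  refine ⟨convex_univ, fun x _ y _ a b ha hb hab => ?_⟩
  have h1 := (convexOn_objective H.convexOn).2 (Set.mem_univ x) (Set.mem_univ y) ha hb hab
  have h2 := norm_combo_sq_le (x - s) (y - s) ha hb hab
  have e : a • (x - s) + b • (y - s) = a • x + b • y - s := by
    have : s = (a + b) • s := by rw [hab, one_smul]
    nth_rewrite 3 [this]
    rw [add_smul, smul_sub, smul_sub]
    abel
  rw [e] at h2
  have h3 := mul_le_mul_of_nonneg_left h2 (show 0 ≤ lam / 2 by positivity)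
  simp only [proxGap, smul_eq_mul] at h1 ⊢
  have h4 : (a + b) * (objective f u + lam / 2 * ‖u - s‖ ^ 2) =
    objective f u + lam / 2 * ‖u - s‖ ^ 2 := by rw [hab, one_mul]
  linarith

/-- The states `(x, x₁ + … + x_t)` of the SVRG loop after `t` iterations. -/
def svrgStates (X : Set (Euc d)) (t : ℕ) : Set (Euc d × Euc d) :=
  {z | z.1 ∈ X ∧ ∃ w ∈ X, z.2 = (t : ℝ) • w}

theorem svrgStates_add (hX : Convex ℝ X) {t : ℕ} {z : Euc d × Euc d} (hz : z ∈ svrgStates X t)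
    {x : Euc d} (hx : x ∈ X) : (x, z.2 + x) ∈ svrgStates X (t + 1) := by
  obtain ⟨_, w, hw, e⟩ := hz
  have ht : (0 : ℝ) < t + 1 := by positivity
  refine ⟨hx, ((t : ℝ) / (t + 1)) • w + (1 / ((t : ℝ) + 1)) • x,
    hX hw hx (by positivity) (by positivity) (by field_simp), ?_⟩
  simp only [e, Nat.cast_succ, smul_add, smul_smul]
  rw [mul_div_cancel₀ _ ht.ne', mul_one_div_cancel ht.ne', one_smul]

/-- The potential of the SVRG loop. -/
def svrgPotential (f : Fin n → Euc d → ℝ) (lam η c : ℝ) (s u : Euc d) (t : ℕ)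
    (z : Euc d × Euc d) : ℝ :=
  (1 - c) * (t * proxGap f lam s u ((t : ℝ)⁻¹ • z.2)) + c * bregObj f u z.1 +
    (2 * η)⁻¹ * ‖z.1 - u‖ ^ 2

/-- Jensen one step at a time. The loop state keeps only the sum of the iterates, so the potential
has to refer to the running average instead of the sum of the gaps. For `t = 0` the meaningless
average is multiplied by zero. -/
theorem proxGap_average_le (H : IsFiniteSumProblem X f L R) {lam : ℝ} (hlam : 0 ≤ lam)
    (s u : Euc d) {t : ℕ} {z : Euc d × Euc d} (hz : z ∈ svrgStates X t) (x : Euc d) :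
    ((t + 1 : ℕ) : ℝ) * proxGap f lam s u (((t + 1 : ℕ) : ℝ)⁻¹ • (z.2 + x)) ≤
      t * proxGap f lam s u ((t : ℝ)⁻¹ • z.2) + proxGap f lam s u x := by
  obtain ⟨_, w, hw, e⟩ := hz
  have ht : (0 : ℝ) < t + 1 := by positivity
  have hw2 : (t : ℝ) * proxGap f lam s u ((t : ℝ)⁻¹ • z.2) = t * proxGap f lam s u w := by
    rcases Nat.eq_zero_or_pos t with h0 | h0
    · simp [h0]
    · rw [e, inv_smul_smul₀ (Nat.cast_pos.2 h0).ne']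
  rw [hw2]
  have h := (H.convexOn_proxGap hlam s u).2 (Set.mem_univ w) (Set.mem_univ x)
    (show 0 ≤ (t : ℝ) / (t + 1) by positivity) (show 0 ≤ 1 / ((t : ℝ) + 1) by positivity)
    (by field_simp)
  have e2 : (((t + 1 : ℕ) : ℝ)⁻¹ • (z.2 + x)) =
      ((t : ℝ) / (t + 1)) • w + (1 / ((t : ℝ) + 1)) • x := by
    rw [e, smul_add, smul_smul, Nat.cast_succ, one_div, div_eq_inv_mul]
  rw [e2, Nat.cast_succ]
  have h2 := mul_le_mul_of_nonneg_left h ht.le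
  refine h2.trans_eq ?_
  simp only [smul_eq_mul]
  field_simp

theorem IsProxPoint.proxGap_nonneg (H : IsFiniteSumProblem X f L R) {lam : ℝ} (hlam : 0 ≤ lam)
    {s u x : Euc d} (hu : IsProxPoint X f lam s u) (hx : x ∈ X) : 0 ≤ proxGap f lam s u x :=
  (add_nonneg (H.bregObj_nonneg u x) (by positivity)).trans (hu.bregObj_add_le hx)

theorem IsProxPoint.bregObj_le_proxGap {lam : ℝ} (hlam : 0 ≤ lam)
    {s u x : Euc d} (hu : IsProxPoint X f lam s u) (hx : x ∈ X) :
    bregObj f u x ≤ proxGap f lam s u x := by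
  have h1 := hu.bregObj_add_le hx
  have h2 : 0 ≤ lam / 2 * ‖x - u‖ ^ 2 := by positivity
  linarith

theorem svrgPotential_nonneg (H : IsFiniteSumProblem X f L R) {lam η c : ℝ} (hlam : 0 ≤ lam)
    (hη : 0 < η) (hc : 0 ≤ c) (hc1 : c ≤ 1) {s u : Euc d} (hu : IsProxPoint X f lam s u) {t : ℕ}
    {z : Euc d × Euc d} (hz : z ∈ svrgStates X t) : 0 ≤ svrgPotential f lam η c s u t z := by
  obtain ⟨h1, w, hw, e⟩ := hz
  have hw2 : 0 ≤ (t : ℝ) * proxGap f lam s u ((t : ℝ)⁻¹ • z.2) := by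
    rcases Nat.eq_zero_or_pos t with h0 | h0
    · simp [h0]
    · rw [e, inv_smul_smul₀ (Nat.cast_pos.2 h0).ne']
      exact mul_nonneg (by positivity) (hu.proxGap_nonneg H hlam hw)
  have h3 := H.bregObj_nonneg u z.1
  have : 0 ≤ 1 - c := by linarith
  unfold svrgPotential
  positivity

/-- One iteration of the SVRG loop. -/
def svrgBody [NeZero n] (X : Set (Euc d)) (O : Oracle n d) (xfull : Euc d) (η : ℝ) (G : Euc d)
    (z : Euc d × Euc d) : QueryM (Euc d × Euc d) := do
  let i ← sample (PMF.uniformOfFintype (Fin n))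
  let a ← O i z.1
  let b ← O i xfull
  let x := proj X (z.1 - η • (a - b + G))
  pure (x, z.2 + x)

theorem oneEpochSvrg_eq [NeZero n] (X : Set (Euc d)) (O : Oracle n d) (xfull xinit : Euc d)
    (η : ℝ) (T : ℕ) :
    oneEpochSvrg X O xfull xinit η T = (fullGradient O xfull >>= fun G =>
      forLoop (fun _ z => svrgBody X O xfull η G z) (xinit, 0) T >>= fun z =>
        pure ((T : ℝ)⁻¹ • z.2)) := rfl

theorem lexp_svrgBody [NeZero n] (f : Fin n → Euc d → ℝ) (lam : ℝ) (s y : Euc d) (η : ℝ)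
    (z : Euc d × Euc d) (g : Euc d × Euc d → ℝ≥0∞) :
    lexp (svrgBody X (detOracle (regGrad f lam s)) y η
      ((n : ℝ)⁻¹ • ∑ j, regGrad f lam s j y) z) g =
    (n : ℝ≥0∞)⁻¹ * ∑ i, g (proj X (z.1 - η • svrgGrad f lam s y z.1 i),
      z.2 + proj X (z.1 - η • svrgGrad f lam s y z.1 i)) := by
  simp only [svrgBody, lexp_bind, lexp_sample_uniform, lexp_detOracle, lexp_pure]
  rfl

theorem resultIn_svrgBody [NeZero n] (H : IsFiniteSumProblem X f L R) (O : Oracle n d)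
    (y : Euc d) (η : ℝ) (G : Euc d) {t : ℕ} {z : Euc d × Euc d} (hz : z ∈ svrgStates X t) :
    (svrgBody X O y η G z).ResultIn (svrgStates X (t + 1)) := by
  refine (resultIn_univ _).bind fun i _ => (resultIn_univ _).bind fun a _ =>
    (resultIn_univ _).bind fun b _ => resultIn_pure ?_
  exact svrgStates_add H.convex hz (proj_spec ⟨_, hz.1⟩ H.isClosed H.convex _).1

theorem init_mem_svrgStates {x : Euc d} (hx : x ∈ X) : (x, (0 : Euc d)) ∈ svrgStates X 0 :=
  ⟨hx, x, hx, by simp⟩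

theorem resultIn_oneEpochSvrg [NeZero n] (H : IsFiniteSumProblem X f L R) (O : Oracle n d)
    (xfull : Euc d) {xinit : Euc d} (hx : xinit ∈ X) (η : ℝ) {T : ℕ} (hT : 0 < T) :
    (oneEpochSvrg X O xfull xinit η T).ResultIn X := by
  rw [oneEpochSvrg_eq]
  refine (resultIn_univ _).bind fun G _ => ?_
  refine (resultIn_forLoop (S := svrgStates X) (init_mem_svrgStates hx)
    (fun t z hz => resultIn_svrgBody H O xfull η G hz) T).bind fun z hz => resultIn_pure ?_
  obtain ⟨_, w, hw, e⟩ := hz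
  rwa [e, inv_smul_smul₀ (Nat.cast_pos.2 hT).ne']

/-- The variance at the current iterate is paid for by a fraction `c` of its own gap, held back one
step earlier: `c V_u(x) ≤ c * proxGap`. Only the contribution of the fixed center accumulates. -/
theorem lexp_svrgBody_le [NeZero n] (H : IsFiniteSumProblem X f L R) (hL : 0 < L)
    {lam η : ℝ} (hlam : 0 ≤ lam) (hη : 0 < η) (hηL : η * (L + lam) ≤ 1 / 8) {u s : Euc d}
    (hu : IsProxPoint X f lam s u) (y : Euc d) {c : ℝ} (hc : c = 16 / 7 * (η * L)) {t : ℕ}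
    {z : Euc d × Euc d} (hz : z ∈ svrgStates X t) :
    lexp (svrgBody X (detOracle (regGrad f lam s)) y η
      ((n : ℝ)⁻¹ • ∑ j, regGrad f lam s j y) z)
      (fun z => ENNReal.ofReal (svrgPotential f lam η c s u (t + 1) z)) ≤
    ENNReal.ofReal (svrgPotential f lam η c s u t z) + ENNReal.ofReal (c * bregObj f u y) := by
  have hc0 : 0 ≤ c := by rw [hc]; positivity
  have hc1 : c ≤ 1 := by
    rw [hc]
    nlinarith [mul_nonneg hη.le hlam]
  have hp : ∀ i, proj X (z.1 - η • svrgGrad f lam s y z.1 i) ∈ X := fun i =>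
    (proj_spec ⟨_, hz.1⟩ H.isClosed H.convex _).1
  rw [lexp_svrgBody, inv_mul_sum_ofReal fun i =>
      svrgPotential_nonneg H hlam hη hc0 hc1 hu (svrgStates_add H.convex hz (hp i)),
    ← ENNReal.ofReal_add (svrgPotential_nonneg H hlam hη hc0 hc1 hu hz)
      (mul_nonneg hc0 (H.bregObj_nonneg _ _))]
  refine ENNReal.ofReal_le_ofReal ?_
  have hstep := H.svrg_step_le hL hlam hη hηL (s := s) hu.1 z.1 y
  rw [← hc] at hstep
  calc _ ≤ (n : ℝ)⁻¹ * ∑ i, ((1 - c) * (t * proxGap f lam s u ((t : ℝ)⁻¹ • z.2)) +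
          (proxGap f lam s u (proj X (z.1 - η • svrgGrad f lam s y z.1 i)) +
        (2 * η)⁻¹ * ‖proj X (z.1 - η • svrgGrad f lam s y z.1 i) - u‖ ^ 2)) := by
        refine inv_mul_sum_le_inv_mul_sum fun i => ?_
        have h1 := mul_le_mul_of_nonneg_left (proxGap_average_le H hlam s u hz
          (proj X (z.1 - η • svrgGrad f lam s y z.1 i))) (sub_nonneg.2 hc1)
        have h2 := mul_le_mul_of_nonneg_left (hu.bregObj_le_proxGap hlam (hp i)) hc0
        simp only [svrgPotential]
        linarith
    _ ≤ _ := by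
        rw [Finset.sum_add_distrib, mul_add, inv_mul_sum_const, svrgPotential]
        linarith

/-- The guarantee of one epoch of SVRG. -/
theorem lexp_oneEpochSvrg_le [NeZero n] (H : IsFiniteSumProblem X f L R) (hL : 0 < L)
    {lam η : ℝ} (hlam : 0 ≤ lam) (hη : 0 < η) (hηL : η * (L + lam) ≤ 1 / 8) {u s : Euc d}
    (hu : IsProxPoint X f lam s u) (xfull : Euc d) {xinit : Euc d} (hx : xinit ∈ X) {T : ℕ}
    (hT : 0 < T) {c : ℝ} (hc : c = 16 / 7 * (η * L)) :
    lexp (oneEpochSvrg X (detOracle (regGrad f lam s)) xfull xinit η T)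
      (fun x => ENNReal.ofReal (proxGap f lam s u x)) ≤
    ENNReal.ofReal (((1 - c) * T)⁻¹ * ((2 * η)⁻¹ * ‖xinit - u‖ ^ 2 + c * bregObj f u xinit +
      T * (c * bregObj f u xfull))) := by
  have hc0 : 0 ≤ c := by rw [hc]; positivity
  have hc1 : c < 1 := by
    rw [hc]
    nlinarith [mul_nonneg hη.le hlam]
  have hT' : (0 : ℝ) < T := Nat.cast_pos.2 hT
  have hk : 0 < (1 - c) * T := mul_pos (by linarith) hT'
  have hb := H.bregObj_nonneg u xinit
  have hb' := H.bregObj_nonneg u xfull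
  rw [oneEpochSvrg_eq, lexp_bind, lexp_fullGradient, lexp_bind]
  simp only [lexp_pure]
  have hloop := lexp_forLoop_le (S := svrgStates X)
    (P := fun t z => ENNReal.ofReal (svrgPotential f lam η c s u t z)) (init_mem_svrgStates hx)
    (fun t z hz => resultIn_svrgBody H (detOracle (regGrad f lam s)) xfull η
      ((n : ℝ)⁻¹ • ∑ j, regGrad f lam s j xfull) hz)
    (fun t z hz => lexp_svrgBody_le H hL hlam hη hηL hu xfull hc hz) T
  have hinit : svrgPotential f lam η c s u 0 (xinit, 0) =
      c * bregObj f u xinit + (2 * η)⁻¹ * ‖xinit - u‖ ^ 2 := by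
    simp [svrgPotential]
  have hres := resultIn_forLoop (S := svrgStates X) (init_mem_svrgStates hx)
    (fun t z hz => resultIn_svrgBody H (detOracle (regGrad f lam s)) xfull η
      ((n : ℝ)⁻¹ • ∑ j, regGrad f lam s j xfull) hz) T
  generalize forLoop (fun _ z => svrgBody X (detOracle (regGrad f lam s)) xfull η
      ((n : ℝ)⁻¹ • ∑ j, regGrad f lam s j xfull) z) (xinit, 0) T = m at hloop hres ⊢
  rw [hinit, ← ENNReal.ofReal_natCast T, ← ENNReal.ofReal_mul hT'.le,
    ← ENNReal.ofReal_add (by positivity) (by positivity)] at hloop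
  calc lexp m (fun z => ENNReal.ofReal (proxGap f lam s u ((T : ℝ)⁻¹ • z.2)))
      ≤ lexp m (fun z => ENNReal.ofReal ((1 - c) * T)⁻¹ *
          ENNReal.ofReal (svrgPotential f lam η c s u T z)) := by
        refine hres.lexp_mono fun z hz => ?_
        rw [← ENNReal.ofReal_mul (by positivity)]
        refine ENNReal.ofReal_le_ofReal ?_
        rw [le_inv_mul_iff₀ hk, svrgPotential]
        have := H.bregObj_nonneg u z.1
        have : 0 ≤ c * bregObj f u z.1 + (2 * η)⁻¹ * ‖z.1 - u‖ ^ 2 := by positivity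
        linarith
    _ = ENNReal.ofReal ((1 - c) * T)⁻¹ *
          lexp m (fun z => ENNReal.ofReal (svrgPotential f lam η c s u T z)) :=
        lexp_const_mul _ _ _
    _ ≤ _ := by
        rw [ENNReal.ofReal_mul (by positivity)]
        gcongr
        refine hloop.trans_eq ?_
        congr 1
        ring

theorem expectedQueries_oneEpochSvrg_le [NeZero n] (X : Set (Euc d))
    (h : Fin n → Euc d → Euc d) (xfull xinit : Euc d) (η : ℝ) (T : ℕ) :
    (oneEpochSvrg X (detOracle h) xfull xinit η T).expectedQueries ≤ n + T * 2 := by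
  rw [oneEpochSvrg_eq]
  refine expectedQueries_bind_le _ _ (expectedQueries_fullGradient h xfull).le fun G => ?_
  rw [← add_zero ((T : ℝ≥0∞) * 2)]
  refine expectedQueries_bind_le _ _ (expectedQueries_forLoop_le _ _ _ fun _ z => ?_)
    fun z => (expectedQueries_pure _).le
  simp only [svrgBody, expectedQueries_bind, expectedQueries_sample, expectedQueries_detOracle,
    expectedQueries_pure, lexp_const]
  norm_num

/-! ### Approximate and unbiased proximal points -/

/-- The guarantee required of an implementation of `ApproxProx`. -/
structure IsApproxProx (X : Set (Euc d)) (f : Fin n → Euc d → ℝ) (lam : ℝ)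
    (approx : Euc d → Euc d → Euc d → QueryM (Euc d)) : Prop where
  resultIn : ∀ s, ∀ xinit ∈ X, ∀ xprev, (approx s xinit xprev).ResultIn X
  lexp_le : ∀ s, ∀ xinit ∈ X, ∀ xprev u, IsProxPoint X f lam s u →
    lexp (approx s xinit xprev) (fun x => ENNReal.ofReal (proxGap f lam s u x)) ≤
      ENNReal.ofReal (1 / 8 * (lam / 2 * ‖xinit - u‖ ^ 2 + bregObj f u xprev))

theorem approxProxSvrg_eq [NeZero n] (X : Set (Euc d)) (f : Fin n → Euc d → ℝ) (hL : 0 < L)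
    (s xinit xprev : Euc d) :
    approxProxSvrg X (gradOracle f) L (L / n) s xinit xprev =
      oneEpochSvrg X (detOracle (regGrad f (L / n) s)) xprev xinit (1 / (32 * L)) (1024 * n) := by
  have hn : (n : ℝ) ≠ 0 := NeZero.ne _
  have e : (32 : ℝ) / (1 / (32 * L) * (L / n)) = ((1024 * n : ℕ) : ℝ) := by
    push_cast
    field_simp
    norm_num
  rw [approxProxSvrg, proxOracle_gradOracle, e, Nat.ceil_natCast]
  rfl

theorem isApproxProx_approxProxSvrg [NeZero n] (H : IsFiniteSumProblem X f L R) (hL : 0 < L) :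
    IsApproxProx X f (L / n) (approxProxSvrg X (gradOracle f) L (L / n)) := by
  have hn : 0 < n := NeZero.pos n
  have hn' : (1 : ℝ) ≤ n := Nat.one_le_cast.2 hn
  have hlam : L / n ≤ L := div_le_self hL.le hn'
  constructor
  · intro s xinit hx xprev
    rw [approxProxSvrg_eq X f hL]
    exact resultIn_oneEpochSvrg H _ _ hx _ (by positivity)
  · intro s xinit hx xprev u hu
    -- With `η = 1/(32 L)` the fraction is `c = 1/14`, and `η (L + lam) ≤ 1/16` because `lam ≤ L`.
    -- The `1024 n` iterations leave ample room for the factor `1/8`.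
    have hc : (1 / 14 : ℝ) = 16 / 7 * (1 / (32 * L) * L) := by field_simp; norm_num
    rw [approxProxSvrg_eq X f hL]
    refine (lexp_oneEpochSvrg_le H hL (by positivity) (by positivity) ?_ hu xprev hx
      (by positivity) hc).trans (ENNReal.ofReal_le_ofReal ?_)
    · rw [div_mul_eq_mul_div, div_le_div_iff₀ (by positivity) (by norm_num)]
      linarith
    · have h1 := H.bregObj_le u xinit
      have h2 := H.bregObj_nonneg u xprev
      have h3 : 0 ≤ L * ‖xinit - u‖ ^ 2 := by positivity
      push_cast
      rw [inv_mul_le_iff₀ (by positivity)]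
      have e1 : (2 * (1 / (32 * L)))⁻¹ = 16 * L := by field_simp; norm_num
      have e2 : (1 - 1 / 14) * (1024 * (n : ℝ)) *
          (1 / 8 * (L / n / 2 * ‖xinit - u‖ ^ 2 + bregObj f u xprev)) =
          13 / 14 * 64 * (L * ‖xinit - u‖ ^ 2) + 13 / 14 * 128 * (n * bregObj f u xprev) := by
        field_simp
        ring
      have h4 : 0 ≤ n * bregObj f u xprev := by positivity
      rw [e1, e2]
      linarith

/-! ### Multilevel Monte Carlo for the proximal point. -/

namespace QueryM

theorem lexp_tsum {α : Type} (m : QueryM α) (c : ℕ → ℝ≥0∞) (F : ℕ → α → ℝ≥0∞) :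
    (lexp m fun a => ∑' k, c k * F k a) = ∑' k, c k * lexp m (F k) := by
  simp only [lexp, ← ENNReal.tsum_mul_left]
  rw [ENNReal.tsum_comm]
  refine tsum_congr fun k => tsum_congr fun z => ?_
  ring

end QueryM

theorem geomHalf_apply (k : ℕ) : geomHalf k = ENNReal.ofReal ((1 / 2) ^ (k + 1)) := by
  have : geomHalf k = 2⁻¹ * 2⁻¹ ^ k := rfl
  rw [this, ENNReal.ofReal_pow (by norm_num), one_div, ENNReal.ofReal_inv_of_pos (by norm_num),
    pow_succ']
  simp

theorem toReal_geomHalf_inv (k : ℕ) : (geomHalf k).toReal⁻¹ = 2 ^ (k + 1) := by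
  rw [geomHalf_apply, ENNReal.toReal_ofReal (by positivity)]
  simp

/-- The chain of pairs of consecutive iterates of `step`, started at `(y, y)`. -/
def pairChain (step : Euc d → QueryM (Euc d)) (y : Euc d) (k : ℕ) : QueryM (Euc d × Euc d) :=
  forLoop (fun _ (w : Euc d × Euc d) => do
    let x ← step w.2
    pure (w.2, x)) (y, y) k

theorem unbiasedProx_eq (approx : Euc d → Euc d → Euc d → QueryM (Euc d)) (j₀ : ℕ)
    (s xprev : Euc d) :
    unbiasedProx approx j₀ s xprev = (approx s s xprev >>= fun x0 =>
      sample geomHalf >>= fun k =>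
        forLoop (fun _ x => approx s x x) x0 j₀ >>= fun xj =>
          pairChain (fun x => approx s x x) xj k >>= fun w =>
            pure (xj + (geomHalf k).toReal⁻¹ • (w.2 - w.1))) := rfl

section PairChain

variable {step : Euc d → QueryM (Euc d)} {y : Euc d}

theorem resultIn_pairChain (hstep : ∀ x ∈ X, (step x).ResultIn X) (hy : y ∈ X) (k : ℕ) :
    (pairChain step y k).ResultIn (X ×ˢ X) :=
  resultIn_forLoop (S := fun _ => X ×ˢ X) ⟨hy, hy⟩ (fun _ w hw =>
    (hstep w.2 hw.2).bind fun _ hx => resultIn_pure ⟨hw.2, hx⟩) k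

/-- The older member of a pair at level `k + 1` has the law of the newer member at level `k`. This
is what makes the levels telescope. -/
theorem lexp_pairChain_succ_fst (g : Euc d → ℝ≥0∞) (k : ℕ) :
    lexp (pairChain step y (k + 1)) (fun w => g w.1) =
      lexp (pairChain step y k) (fun w => g w.2) := by
  rw [pairChain, lexp_forLoop_succ]
  simp only [lexp_bind, lexp_pure, lexp_const]
  rfl

theorem lexp_pairChain_snd_le (hstep : ∀ x ∈ X, (step x).ResultIn X) (hy : y ∈ X)
    {P : Euc d → ℝ≥0∞} {ρ : ℝ≥0∞} (hP : ∀ x ∈ X, lexp (step x) P ≤ ρ * P x) (k : ℕ) :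
    lexp (pairChain step y k) (fun w => P w.2) ≤ ρ ^ k * P y := by
  refine lexp_forLoop_le_pow (S := X ×ˢ X) (P := fun w : Euc d × Euc d => P w.2)
    (show (y, y) ∈ X ×ˢ X from ⟨hy, hy⟩) (fun _ w hw =>
    (hstep w.2 hw.2).bind fun _ hx => resultIn_pure ⟨hw.2, hx⟩) (fun _ w hw => ?_) k
  simp only [lexp_bind, lexp_pure]
  exact hP w.2 hw.2

/-- A contracting chain, in real terms. -/
theorem lexp_pairChain_snd_ofReal_le (hstep : ∀ x ∈ X, (step x).ResultIn X) (hy : y ∈ X)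
    {Ψ : Euc d → ℝ}
    (hP : ∀ x ∈ X, lexp (step x) (fun x => ENNReal.ofReal (Ψ x)) ≤ ENNReal.ofReal (1 / 8 * Ψ x))
    {b : ℝ} (hb : 0 ≤ b) (k : ℕ) :
    lexp (pairChain step y k) (fun w => ENNReal.ofReal (b * Ψ w.2)) ≤
      ENNReal.ofReal (b * ((1 / 8) ^ k * Ψ y)) := by
  rw [lexp_ofReal_mul _ hb, ENNReal.ofReal_mul hb, ENNReal.ofReal_mul (by positivity),
    ENNReal.ofReal_pow (by norm_num)]
  gcongr
  refine lexp_pairChain_snd_le hstep hy (P := fun x => ENNReal.ofReal (Ψ x)) (fun x hx => ?_) k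
  rw [← ENNReal.ofReal_mul (by norm_num)]
  exact hP x hx

/-- Expanding the square, the cross term `2⟨a, w₂ - w₁⟩` is a difference of the same quantity at
`w₂` and `w₁`. It is kept on both sides, shifted by `M`, since only nonnegative functions have
expectations here. -/
theorem level_identity (a w₁ w₂ u : Euc d) (M : ℝ) {c : ℝ} (hc : 0 < c) :
    c⁻¹ * ‖a + c • (w₂ - w₁)‖ ^ 2 + 2 * (inner ℝ a (w₁ - u) + M) =
      (c⁻¹ * ‖a‖ ^ 2 + c * ‖w₂ - w₁‖ ^ 2) + 2 * (inner ℝ a (w₂ - u) + M) := by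
  rw [norm_add_sq_real, inner_smul_right, norm_smul, Real.norm_of_nonneg hc.le]
  have : inner ℝ a (w₂ - u) = inner ℝ a (w₂ - w₁) + inner ℝ a (w₁ - u) := by
    rw [← inner_add_right, sub_add_sub_cancel]
  rw [this]
  field_simp
  ring

/-- One level of the multilevel estimate. -/
theorem lexp_level_add_le (hstep : ∀ x ∈ X, (step x).ResultIn X) (hy : y ∈ X)
    {Ψ : Euc d → ℝ} {lam : ℝ} (hlam : 0 < lam) {u a : Euc d} {M : ℝ}
    (hΨ : ∀ x ∈ X, lam / 2 * ‖x - u‖ ^ 2 ≤ Ψ x)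
    (hM : ∀ x ∈ X, 0 ≤ inner ℝ a (x - u) + M)
    (hP : ∀ x ∈ X, lexp (step x) (fun x => ENNReal.ofReal (Ψ x)) ≤ ENNReal.ofReal (1 / 8 * Ψ x))
    (k : ℕ) :
    lexp (pairChain step y (k + 1))
        (fun w => ENNReal.ofReal ((1 / 2) ^ (k + 2) * ‖a + (2 : ℝ) ^ (k + 2) • (w.2 - w.1)‖ ^ 2)) +
      lexp (pairChain step y k) (fun w => ENNReal.ofReal (2 * (inner ℝ a (w.2 - u) + M))) ≤
    ENNReal.ofReal ((1 / 2) ^ (k + 2) * ‖a‖ ^ 2 + 18 / lam * (1 / 4) ^ k * Ψ y) +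
      lexp (pairChain step y (k + 1))
        (fun w => ENNReal.ofReal (2 * (inner ℝ a (w.2 - u) + M))) := by
  have hres := resultIn_pairChain hstep hy (k + 1)
  have hΨ0 : ∀ x ∈ X, 0 ≤ Ψ x := fun x hx => (by positivity : (0 : ℝ) ≤ _).trans (hΨ x hx)
  rw [← lexp_pairChain_succ_fst (fun x => ENNReal.ofReal (2 * (inner ℝ a (x - u) + M))) k]
  rw [← lexp_ofReal_add _ hres (fun w _ => by positivity)
    (fun w hw => mul_nonneg zero_le_two (hM _ hw.1))]
  set c : ℝ := 2 ^ (k + 2) with hc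
  have hc0 : 0 < c := by positivity
  have hci : ((1 : ℝ) / 2) ^ (k + 2) = c⁻¹ := by simp [hc]
  simp only [hci, level_identity _ _ _ u M hc0]
  rw [lexp_ofReal_add _ hres (fun w _ => by positivity)
    (fun w hw => mul_nonneg zero_le_two (hM _ hw.2))]
  gcongr
  calc _ ≤ lexp (pairChain step y (k + 1)) (fun w => ENNReal.ofReal (c⁻¹ * ‖a‖ ^ 2) +
          (ENNReal.ofReal (4 * c / lam * Ψ w.2) + ENNReal.ofReal (4 * c / lam * Ψ w.1))) := by
        refine hres.lexp_mono fun w hw => ?_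
        have h1 := hΨ0 _ hw.1
        have h2 := hΨ0 _ hw.2
        rw [← ENNReal.ofReal_add (by positivity) (by positivity),
          ← ENNReal.ofReal_add (by positivity) (by positivity)]
        refine ENNReal.ofReal_le_ofReal (by
          have h3 := hΨ _ hw.1
          have h4 := hΨ _ hw.2
          have h5 : ‖w.2 - w.1‖ ^ 2 ≤ 2 * ‖w.2 - u‖ ^ 2 + 2 * ‖w.1 - u‖ ^ 2 := by
            have e : w.2 - w.1 = (w.2 - u) - (w.1 - u) := by abel
            have := parallelogram_law_with_norm ℝ (w.2 - u) (w.1 - u)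
            rw [e]
            nlinarith [sq_nonneg ‖(w.2 - u) + (w.1 - u)‖]
          have h6 : 2 * ‖w.2 - u‖ ^ 2 + 2 * ‖w.1 - u‖ ^ 2 ≤ 4 / lam * (Ψ w.2 + Ψ w.1) := by
            rw [div_mul_eq_mul_div, le_div_iff₀ hlam]
            linarith
          have h7 := mul_le_mul_of_nonneg_left (h5.trans h6) hc0.le
          refine (add_le_add_right h7 _).trans_eq ?_
          ring)
    _ ≤ ENNReal.ofReal (c⁻¹ * ‖a‖ ^ 2) +
          (ENNReal.ofReal (4 * c / lam * ((1 / 8) ^ (k + 1) * Ψ y)) +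
            ENNReal.ofReal (4 * c / lam * ((1 / 8) ^ k * Ψ y))) := by
        rw [lexp_add, lexp_const, lexp_add,
          lexp_pairChain_succ_fst (fun x => ENNReal.ofReal (4 * c / lam * Ψ x)) k]
        gcongr
        · exact lexp_pairChain_snd_ofReal_le hstep hy hP (by positivity) _
        · exact lexp_pairChain_snd_ofReal_le hstep hy hP (by positivity) _
    _ = _ := by
        have h1 := hΨ0 _ hy
        rw [← ENNReal.ofReal_add (by positivity) (by positivity),
          ← ENNReal.ofReal_add (by positivity) (by positivity)]
        congr 2
        -- The weight of the level times the contraction is `4 (1/4)^k` for the older iterate and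
        -- `1/2 (1/4)^k` for the newer one; `4 (4 + 1/2) = 18`.
        have e : (2 : ℝ) ^ (k + 2) * (1 / 8) ^ k = 4 * (1 / 4) ^ k := by
          rw [pow_add, mul_right_comm, ← mul_pow]
          norm_num [mul_comm]
        have e2 : c * (1 / 8) ^ (k + 1) = 1 / 2 * (1 / 4) ^ k := by
          rw [pow_succ, ← mul_assoc, hc, e]; ring
        calc _ = 4 / lam * (c * (1 / 8) ^ (k + 1) + c * (1 / 8) ^ k) * Ψ y := by ring
          _ = _ := by rw [e2, hc, e]; ring

/-- The level bounds telescope: the weights `(1/2)^(k+1)` sum to `1 - (1/2)^(K+1)`, and the errors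
`18 (1/4)^k` to `24 (1 - (1/4)^K)`. Level zero has equal members and contributes `‖a‖²/2` only. -/
theorem sum_level_add_le (hstep : ∀ x ∈ X, (step x).ResultIn X) (hy : y ∈ X)
    {Ψ : Euc d → ℝ} {lam : ℝ} (hlam : 0 < lam) {u a : Euc d} {M : ℝ}
    (hΨ : ∀ x ∈ X, lam / 2 * ‖x - u‖ ^ 2 ≤ Ψ x)
    (hM : ∀ x ∈ X, 0 ≤ inner ℝ a (x - u) + M)
    (hP : ∀ x ∈ X, lexp (step x) (fun x => ENNReal.ofReal (Ψ x)) ≤ ENNReal.ofReal (1 / 8 * Ψ x))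
    (K : ℕ) :
    ∑ k ∈ Finset.range (K + 1), lexp (pairChain step y k)
        (fun w => ENNReal.ofReal ((1 / 2) ^ (k + 1) * ‖a + (2 : ℝ) ^ (k + 1) • (w.2 - w.1)‖ ^ 2)) +
      ENNReal.ofReal (2 * (inner ℝ a (y - u) + M)) ≤
    ENNReal.ofReal ((1 - (1 / 2) ^ (K + 1)) * ‖a‖ ^ 2 + 24 / lam * (1 - (1 / 4) ^ K) * Ψ y) +
      lexp (pairChain step y K) (fun w => ENNReal.ofReal (2 * (inner ℝ a (w.2 - u) + M))) := by
  have hΨy : 0 ≤ Ψ y := (by positivity : (0 : ℝ) ≤ _).trans (hΨ y hy)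
  induction K with
  | zero =>
    simp only [pairChain, forLoop, lexp_pure, zero_add, Finset.range_one, Finset.sum_singleton]
    gcongr
    norm_num
  | succ K ih =>
    have h := lexp_level_add_le hstep hy hlam hΨ hM hP K
    rw [Finset.sum_range_succ]
    set S := ∑ k ∈ Finset.range (K + 1), lexp (pairChain step y k)
        (fun w => ENNReal.ofReal ((1 / 2) ^ (k + 1) * ‖a + (2 : ℝ) ^ (k + 1) • (w.2 - w.1)‖ ^ 2))
    set D := lexp (pairChain step y (K + 1)) (fun w => ENNReal.ofReal
      ((1 / 2) ^ (K + 1 + 1) * ‖a + (2 : ℝ) ^ (K + 1 + 1) • (w.2 - w.1)‖ ^ 2))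
    set e := lexp (pairChain step y K)
      (fun w => ENNReal.ofReal (2 * (inner ℝ a (w.2 - u) + M)))
    set e' := lexp (pairChain step y (K + 1))
      (fun w => ENNReal.ofReal (2 * (inner ℝ a (w.2 - u) + M)))
    have hq : ((1 : ℝ) / 4) ^ K ≤ 1 := pow_le_one₀ (by norm_num) (by norm_num)
    have hh : ((1 : ℝ) / 2) ^ (K + 1) ≤ 1 := pow_le_one₀ (by norm_num) (by norm_num)
    have hA : 0 ≤ (1 - ((1 : ℝ) / 2) ^ (K + 1)) * ‖a‖ ^ 2 :=
      mul_nonneg (sub_nonneg.2 hh) (by positivity)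
    have hB : 0 ≤ 24 / lam * (1 - (1 / 4) ^ K) * Ψ y :=
      mul_nonneg (mul_nonneg (by positivity) (sub_nonneg.2 hq)) hΨy
    calc S + D + ENNReal.ofReal (2 * (inner ℝ a (y - u) + M))
        = (S + ENNReal.ofReal (2 * (inner ℝ a (y - u) + M))) + D := by ring
      _ ≤ (ENNReal.ofReal ((1 - (1 / 2) ^ (K + 1)) * ‖a‖ ^ 2 +
            24 / lam * (1 - (1 / 4) ^ K) * Ψ y) + e) + D := by gcongr
      _ = ENNReal.ofReal ((1 - (1 / 2) ^ (K + 1)) * ‖a‖ ^ 2 +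
            24 / lam * (1 - (1 / 4) ^ K) * Ψ y) + (D + e) := by ring
      _ ≤ ENNReal.ofReal ((1 - (1 / 2) ^ (K + 1)) * ‖a‖ ^ 2 +
            24 / lam * (1 - (1 / 4) ^ K) * Ψ y) +
          (ENNReal.ofReal ((1 / 2) ^ (K + 2) * ‖a‖ ^ 2 + 18 / lam * (1 / 4) ^ K * Ψ y) + e') := by
          gcongr
      _ = _ := by
          rw [← add_assoc, ← ENNReal.ofReal_add (by positivity) (by positivity)]
          congr 2
          ring

/-- The mean square distance of the multilevel estimator to a point `p`, given the base point
`y`. -/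
theorem tsum_level_le (hstep : ∀ x ∈ X, (step x).ResultIn X) (hy : y ∈ X)
    (hR : ∀ x ∈ X, ∀ z ∈ X, ‖x - z‖ ≤ R)
    {Ψ : Euc d → ℝ} {lam : ℝ} (hlam : 0 < lam) {u : Euc d} (hu : u ∈ X)
    (hΨ : ∀ x ∈ X, lam / 2 * ‖x - u‖ ^ 2 ≤ Ψ x)
    (hP : ∀ x ∈ X, lexp (step x) (fun x => ENNReal.ofReal (Ψ x)) ≤ ENNReal.ofReal (1 / 8 * Ψ x))
    (p : Euc d) :
    ∑' k, geomHalf k * lexp (pairChain step y k)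
        (fun w => ENNReal.ofReal (‖y + (geomHalf k).toReal⁻¹ • (w.2 - w.1) - p‖ ^ 2)) ≤
    ENNReal.ofReal (‖u - p‖ ^ 2 + 24 / lam * Ψ y) := by
  have hΨy : 0 ≤ Ψ y := (by positivity : (0 : ℝ) ≤ _).trans (hΨ y hy)
  set a := y - p with ha
  -- The shift `‖a‖ R` makes the cross term nonnegative on `X`; it cancels at the end.
  have hM : ∀ x ∈ X, 0 ≤ inner ℝ a (x - u) + ‖a‖ * R := by
    intro x hx
    have h1 := abs_le.1 (abs_real_inner_le_norm a (x - u))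
    have h2 := mul_le_mul_of_nonneg_left (hR x hx u hu) (norm_nonneg a)
    linarith
  have hterm : ∀ k, geomHalf k * lexp (pairChain step y k)
        (fun w => ENNReal.ofReal (‖y + (geomHalf k).toReal⁻¹ • (w.2 - w.1) - p‖ ^ 2)) =
      lexp (pairChain step y k) (fun w => ENNReal.ofReal
        ((1 / 2) ^ (k + 1) * ‖a + (2 : ℝ) ^ (k + 1) • (w.2 - w.1)‖ ^ 2)) := by
    intro k
    rw [toReal_geomHalf_inv, geomHalf_apply, ← lexp_ofReal_mul _ (by positivity)]
    simp only [ha, sub_add_eq_add_sub]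
  simp only [hterm]
  refine ENNReal.tsum_le_of_sum_range_le fun K => ?_
  refine (Finset.sum_le_sum_of_subset (Finset.range_mono (Nat.le_succ K))).trans ?_
  have h := sum_level_add_le hstep hy hlam hΨ hM hP K
  have he : lexp (pairChain step y K)
      (fun w => ENNReal.ofReal (2 * (inner ℝ a (w.2 - u) + ‖a‖ * R))) ≤
      ENNReal.ofReal (2 * (‖a‖ * R) + (1 / 2) ^ (K + 1) * ‖a‖ ^ 2 +
        4 / lam * (1 / 4) ^ K * Ψ y) := by
    have hRn : 0 ≤ ‖a‖ * R := mul_nonneg (norm_nonneg a) ((norm_nonneg _).trans (hR y hy u hu))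
    calc _ ≤ lexp (pairChain step y K) (fun w => ENNReal.ofReal (2 * (‖a‖ * R) +
            (1 / 2) ^ (K + 1) * ‖a‖ ^ 2) + ENNReal.ofReal (4 * 2 ^ K / lam * Ψ w.2)) := by
          refine (resultIn_pairChain hstep hy K).lexp_mono fun w hw => ?_
          have h2 := hΨ _ hw.2
          have h1 : 0 ≤ Ψ w.2 := (by positivity : (0 : ℝ) ≤ _).trans h2
          rw [← ENNReal.ofReal_add (by positivity) (by positivity)]
          refine ENNReal.ofReal_le_ofReal ?_
          -- The choice `θ = 2^K` turns the remaining cross term into `(1/2)^(K+1) ‖a‖²` plus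
          -- `O((1/4)^K)`, which fits the deficits of the partial sums. Every partial sum thus obeys
          -- the final bound and no limit is needed.
          have h3 := inner_le_young a (w.2 - u) (θ := 2 ^ K) (by positivity)
          have h4 : ‖w.2 - u‖ ^ 2 ≤ 2 / lam * Ψ w.2 := by
            rw [div_mul_eq_mul_div, le_div_iff₀ hlam]
            linarith
          have h5 := mul_le_mul_of_nonneg_left h4 (show (0 : ℝ) ≤ 2 ^ K by positivity)
          have h6 : (4 * (2 : ℝ) ^ K)⁻¹ = 1 / 2 * (1 / 2) ^ (K + 1) := by
            rw [mul_inv, pow_succ, one_div, inv_pow]; ring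
          rw [h6] at h3
          have h7 : 4 * 2 ^ K / lam * Ψ w.2 = 2 * (2 ^ K * (2 / lam * Ψ w.2)) := by ring
          rw [h7]
          linarith
      _ ≤ ENNReal.ofReal (2 * (‖a‖ * R) + (1 / 2) ^ (K + 1) * ‖a‖ ^ 2) +
            ENNReal.ofReal (4 * 2 ^ K / lam * ((1 / 8) ^ K * Ψ y)) := by
          rw [lexp_add, lexp_const]
          gcongr
          exact lexp_pairChain_snd_ofReal_le hstep hy hP (by positivity) K
      _ = _ := by
          rw [← ENNReal.ofReal_add (by positivity) (by positivity)]
          congr 2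
          have e : (2 : ℝ) ^ K * (1 / 8) ^ K = (1 / 4) ^ K := by
            rw [← mul_pow]; norm_num
          rw [← e]
          ring
  have hq : ((1 : ℝ) / 4) ^ K ≤ 1 := pow_le_one₀ (by norm_num) (by norm_num)
  have hq0 : (0 : ℝ) ≤ (1 / 4) ^ K := by positivity
  have hh : ((1 : ℝ) / 2) ^ (K + 1) ≤ 1 := pow_le_one₀ (by norm_num) (by norm_num)
  have hA : 0 ≤ (1 - ((1 : ℝ) / 2) ^ (K + 1)) * ‖a‖ ^ 2 :=
    mul_nonneg (sub_nonneg.2 hh) (by positivity)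
  have hB : 0 ≤ 24 / lam * (1 - (1 / 4) ^ K) * Ψ y :=
    mul_nonneg (mul_nonneg (by positivity) (sub_nonneg.2 hq)) hΨy
  have hRn : 0 ≤ ‖a‖ * R := mul_nonneg (norm_nonneg a) ((norm_nonneg _).trans (hR y hy u hu))
  have h1 := h.trans (add_le_add_right he _)
  rw [← ENNReal.ofReal_add (by positivity) (by positivity)] at h1
  -- Subtracting the shifted cross term at `y` completes the square: `‖a‖² - 2⟨a, y - u⟩ ≤ ‖u -
  -- p‖²`, as `u - p = a - (y - u)`.
  refine (ENNReal.le_sub_of_add_le_right ENNReal.ofReal_ne_top h1).trans ?_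
  rw [← ENNReal.ofReal_sub _ (mul_nonneg zero_le_two (hM y hy))]
  refine ENNReal.ofReal_le_ofReal ?_
  have e1 : ‖u - p‖ ^ 2 = ‖a‖ ^ 2 - 2 * inner ℝ a (y - u) + ‖y - u‖ ^ 2 := by
    rw [← norm_sub_sq_real, ha]
    congr 2
    abel
  have h2 : 0 ≤ lam⁻¹ * ((1 / 4) ^ K * Ψ y) := by positivity
  rw [e1]
  have e2 : 24 / lam * (1 - (1 / 4) ^ K) * Ψ y =
    24 / lam * Ψ y - 24 * (lam⁻¹ * ((1 / 4) ^ K * Ψ y)) := by ring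
  have e3 : 4 / lam * (1 / 4) ^ K * Ψ y = 4 * (lam⁻¹ * ((1 / 4) ^ K * Ψ y)) := by ring
  rw [e2, e3]
  nlinarith [sq_nonneg ‖y - u‖]

end PairChain

/-- `UnbiasedProx` is centered at the proximal point, with small variance. -/
theorem IsApproxProx.lexp_unbiasedProx_le (H : IsFiniteSumProblem X f L R) {lam : ℝ}
    (hlam : 0 < lam) {approx : Euc d → Euc d → Euc d → QueryM (Euc d)}
    (A : IsApproxProx X f lam approx) {s u : Euc d} (hs : s ∈ X) (xprev : Euc d)
    (hu : IsProxPoint X f lam s u) (p : Euc d) :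
    lexp (unbiasedProx approx 2 s xprev) (fun x => ENNReal.ofReal (‖x - p‖ ^ 2)) ≤
      ENNReal.ofReal (‖u - p‖ ^ 2 +
        3 / (64 * lam) * (lam / 2 * ‖s - u‖ ^ 2 + bregObj f u xprev)) := by
  have hstep : ∀ x ∈ X, (approx s x x).ResultIn X := fun x hx => A.resultIn s x hx x
  have hΨ : ∀ x ∈ X, lam / 2 * ‖x - u‖ ^ 2 ≤ proxGap f lam s u x := fun x hx => by
    linarith [hu.bregObj_add_le hx, H.bregObj_nonneg u x]
  -- With initial point and center both equal to `x`, the error measure is at most the prox gap of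
  -- `x`, so a call contracts the gap by `1/8`.
  have hP : ∀ x ∈ X, lexp (approx s x x) (fun x => ENNReal.ofReal (proxGap f lam s u x)) ≤
      ENNReal.ofReal (1 / 8 * proxGap f lam s u x) := fun x hx => by
    refine (A.lexp_le s x hx x u hu).trans (ENNReal.ofReal_le_ofReal ?_)
    linarith [hu.bregObj_add_le hx]
  have hW : 0 ≤ lam / 2 * ‖s - u‖ ^ 2 + bregObj f u xprev :=
    add_nonneg (by positivity) (H.bregObj_nonneg u xprev)
  rw [unbiasedProx_eq]
  simp only [lexp_bind, lexp_sample, lexp_pure]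
  calc _ = lexp (approx s s xprev) (fun x0 => lexp (forLoop (fun _ x => approx s x x) x0 2)
          fun y => ∑' k, geomHalf k * lexp (pairChain (fun x => approx s x x) y k)
            (fun w => ENNReal.ofReal (‖y + (geomHalf k).toReal⁻¹ • (w.2 - w.1) - p‖ ^ 2))) := by
        simp only [lexp_tsum]
    _ ≤ lexp (approx s s xprev) (fun x0 => ENNReal.ofReal (‖u - p‖ ^ 2) +
          ENNReal.ofReal (24 / lam * (1 / 8) ^ 2) * ENNReal.ofReal (proxGap f lam s u x0)) := by
        refine (A.resultIn s s hs xprev).lexp_mono fun x0 hx0 => ?_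
        have hres := resultIn_forLoop (S := fun _ => X) hx0
          (fun _ x hx => hstep x hx) 2
        have hpow := lexp_forLoop_le_pow (body := fun _ x => approx s x x) (S := X)
          (P := fun x => ENNReal.ofReal (proxGap f lam s u x)) (ρ := ENNReal.ofReal (1 / 8)) hx0
          (fun _ x hx => hstep x hx) (fun _ x hx => by
            rw [← ENNReal.ofReal_mul (by norm_num)]
            exact hP x hx) 2
        refine (hres.lexp_mono fun y hy =>
          tsum_level_le hstep hy H.diam_le hlam hu.1 hΨ hP p).trans ?_
        rw [lexp_ofReal_add _ hres (fun _ _ => by positivity) (fun y hy =>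
          mul_nonneg (by positivity) (hu.proxGap_nonneg H hlam.le hy)), lexp_const,
          lexp_ofReal_mul _ (by positivity), ENNReal.ofReal_mul (by positivity), mul_assoc]
        gcongr
        rw [ENNReal.ofReal_pow (by norm_num)]
        exact hpow
    _ ≤ ENNReal.ofReal (‖u - p‖ ^ 2) + ENNReal.ofReal (24 / lam * (1 / 8) ^ 2) *
          ENNReal.ofReal (1 / 8 * (lam / 2 * ‖s - u‖ ^ 2 + bregObj f u xprev)) := by
        rw [lexp_add, lexp_const, lexp_const_mul]
        gcongr
        exact A.lexp_le s s hs xprev u hu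
    -- One call from `xprev` and two more from the offset give `24 / 8³ = 3/64`.
    _ = _ := by
        rw [← ENNReal.ofReal_mul (by positivity), ← ENNReal.ofReal_add (by positivity)
          (by positivity)]
        congr 2
        field_simp
        ring

/-! ### RECAPP iterations -/

theorem alpha_pos (t : ℕ) : 0 < alpha t := by
  cases t with
  | zero => exact zero_lt_one
  | succ t => exact (alpha_spec t).2.1.1

/-- The largest value is `alpha 1 = 2 / (1 + √5) < 0.62`. Being bounded away from `1` keeps a
positive multiple of `V_u(x)` available in the potential argument. -/
theorem alpha_succ_le (t : ℕ) : alpha (t + 1) ≤ 62 / 100 := by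
  have h0 := alpha_pos t
  have h1 : alpha t ≤ 1 := by
    cases t with
    | zero => exact le_refl 1
    | succ t => exact (alpha_spec t).2.1.2
  have h2 : (4 : ℝ) ≤ 4 / alpha t ^ 2 := by
    rw [le_div_iff₀ (by positivity)]
    nlinarith
  have h3 : (223 / 100 : ℝ) ≤ √(1 + 4 / alpha t ^ 2) :=
    Real.le_sqrt_of_sq_le (by norm_num; linarith)
  simp only [alpha]
  rw [div_le_iff₀ (by positivity)]
  linarith

/-- The recursion for the coefficients is chosen so that consecutive potentials match. -/
theorem one_sub_alpha_div (t : ℕ) :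
    (1 - alpha (t + 1)) / alpha (t + 1) ^ 2 = 1 / alpha t ^ 2 := by
  rw [← (alpha_spec t).2.2]
  have := alpha_pos (t + 1)
  field_simp

theorem le_inv_alpha (t : ℕ) : ((t : ℝ) + 2) / 2 ≤ (alpha t)⁻¹ := by
  induction t with
  | zero => simp [alpha]
  | succ t ih =>
    have h0 := alpha_pos t
    have h1 : 2 / alpha t ≤ √(1 + 4 / alpha t ^ 2) := by
      refine Real.le_sqrt_of_sq_le ?_
      rw [div_pow]
      norm_num
    simp only [alpha]
    rw [inv_div]
    push_cast
    have : 2 / alpha t = 2 * (alpha t)⁻¹ := by ring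
    linarith

/-- One iteration of RECAPP with coefficient `a`. -/
def recappBody (X : Set (Euc d)) (approx : Euc d → Euc d → Euc d → QueryM (Euc d)) (j₀ : ℕ)
    (a : ℝ) (z : Euc d × Euc d) : QueryM (Euc d × Euc d) := do
  let s := (1 - a) • z.1 + a • z.2
  let x ← approx s s z.1
  let xt ← unbiasedProx approx j₀ s z.1
  let v := proj X (z.2 - a⁻¹ • (s - xt))
  pure (x, v)

theorem recappLoop_eq (X : Set (Euc d)) (approx : Euc d → Euc d → Euc d → QueryM (Euc d))
    (j₀ T : ℕ) (xstart : Euc d) :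
    recappLoop X approx j₀ T xstart =
      (forLoop (fun t z => recappBody X approx j₀ (alpha (t + 1)) z) (xstart, xstart) T >>=
        fun z => pure z.1) := rfl

/-- The optimality of `u` is tested against `x` and `z` with weights `1 - a` and `a`, and `s` is the
matching combination of `x` and `v`. Convexity suffices at `z`, but the divergence at `x` is
retained: it pays for centering SVRG at `x`. -/
theorem IsProxPoint.objective_le {lam : ℝ} {s u : Euc d}
    (H : IsFiniteSumProblem X f L R) (hu : IsProxPoint X f lam s u) {x v z : Euc d} (hx : x ∈ X)
    (hz : z ∈ X) {a : ℝ} (ha : 0 ≤ a) (ha1 : a ≤ 1) (hs : s = (1 - a) • x + a • v) :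
    objective f u ≤ (1 - a) * objective f x + a * objective f z - lam * ‖s - u‖ ^ 2 +
      a * lam * inner ℝ (s - u) (v - z) - (1 - a) * bregObj f u x := by
  have h1 := mul_nonneg (sub_nonneg.2 ha1) (hu.2 x hx)
  have h2 := mul_nonneg ha (hu.2 z hz)
  have h3 := mul_nonneg ha (H.bregObj_nonneg u z)
  have e : s - u + a • (z - v) = (1 - a) • (x - u) + a • (z - u) := by
    rw [hs]
    module
  have e2 : ‖s - u‖ ^ 2 - a * inner ℝ (s - u) (v - z) =
      (1 - a) * inner ℝ (s - u) (x - u) + a * inner ℝ (s - u) (z - u) := by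
    rw [← real_inner_smul_right (s - u) (x - u), ← real_inner_smul_right (s - u) (z - u),
      ← inner_add_right, ← e,
      inner_add_right, real_inner_self_eq_norm_sq, inner_smul_right, ← neg_sub v z,
      inner_neg_right]
    ring
  have e3 : lam • (u - s) = -(lam • (s - u)) := by rw [← smul_neg, neg_sub]
  rw [e3, inner_add_left, inner_neg_left, real_inner_smul_left] at h1 h2
  simp only [bregObj] at h3 ⊢
  have e4 := congrArg (fun r => lam * r) e2
  linarith

/-- Doubling the prox gap halves the coefficient of `‖s - u‖²` from `lam/2` to `lam/4`. With `lam/2`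
the negative term of `IsProxPoint.objective_le` would be exhausted, leaving nothing to absorb the
prox errors. -/
theorem IsProxPoint.objective_sub_le {lam : ℝ} (hlam : 0 ≤ lam) {s u : Euc d}
    (H : IsFiniteSumProblem X f L R) (hu : IsProxPoint X f lam s u) {x : Euc d} (hx : x ∈ X) :
    objective f x ≤ 2 * proxGap f lam s u x + (objective f u + lam / 4 * ‖s - u‖ ^ 2) := by
  have h1 := hu.bregObj_add_le hx
  have h2 := H.bregObj_nonneg u x
  have h3 : ‖u - s‖ ^ 2 ≤ 2 * ‖x - s‖ ^ 2 + 2 * ‖x - u‖ ^ 2 := by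
    have e : u - s = (x - s) - (x - u) := by abel
    have := parallelogram_law_with_norm ℝ (x - s) (x - u)
    rw [e]
    nlinarith [sq_nonneg ‖(x - s) + (x - u)‖]
  have h4 := mul_le_mul_of_nonneg_left h3 hlam
  have e : proxGap f lam s u x =
    objective f x + lam / 2 * ‖x - s‖ ^ 2 - (objective f u + lam / 2 * ‖u - s‖ ^ 2) := rfl
  rw [norm_sub_rev s u]
  linarith

theorem IsApproxProx.resultIn_recappBody (H : IsFiniteSumProblem X f L R) {lam : ℝ}
    {approx : Euc d → Euc d → Euc d → QueryM (Euc d)} (A : IsApproxProx X f lam approx)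
    (j₀ : ℕ) {a : ℝ} (ha : 0 ≤ a) (ha1 : a ≤ 1) {w : Euc d × Euc d} (hw : w ∈ X ×ˢ X) :
    (recappBody X approx j₀ a w).ResultIn (X ×ˢ X) :=
  (A.resultIn _ _ (H.convex hw.1 hw.2 (sub_nonneg.2 ha1) ha (by ring)) _).bind fun x hx =>
    (resultIn_univ _).bind fun _ _ => resultIn_pure
      ⟨hx, (proj_spec ⟨x, hx⟩ H.isClosed H.convex _).1⟩

/-- The potential of RECAPP does not increase in expectation. -/
theorem IsApproxProx.lexp_recappBody_le (H : IsFiniteSumProblem X f L R) {lam : ℝ}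
    (hlam : 0 < lam) {approx : Euc d → Euc d → Euc d → QueryM (Euc d)}
    (A : IsApproxProx X f lam approx) {s₀ z : Euc d} (hz : IsProxPoint X f 0 s₀ z) {a : ℝ}
    (ha : 0 < a) (ha1 : a ≤ 62 / 100) {w : Euc d × Euc d} (hw : w ∈ X ×ˢ X) :
    lexp (recappBody X approx 2 a w) (fun w' => ENNReal.ofReal
      (1 / a ^ 2 * (objective f w'.1 - objective f z) + lam / 2 * ‖w'.2 - z‖ ^ 2)) ≤
    ENNReal.ofReal ((1 - a) / a ^ 2 * (objective f w.1 - objective f z) +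
      lam / 2 * ‖w.2 - z‖ ^ 2) := by
  obtain ⟨x, v⟩ := w
  have hx : x ∈ X := hw.1
  have hv : v ∈ X := hw.2
  set s := (1 - a) • x + a • v with hs
  have hsX : s ∈ X := H.convex hx hv (by linarith) ha.le (by ring)
  obtain ⟨u, hu⟩ := H.exists_isProxPoint ⟨x, hx⟩ lam s
  have hmin := fun y (hy : y ∈ X) => H.objective_le_of_isProxPoint hz hy
  set W := lam / 2 * ‖s - u‖ ^ 2 + bregObj f u x with hW
  have hV := H.bregObj_nonneg u x
  have hW0 : 0 ≤ W := by positivity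
  -- With this `p` the unprojected update satisfies `v - a⁻¹ (s - x̃) - z = a⁻¹ (x̃ - p)`, so the
  -- second-moment bound of the unbiased estimator applies directly.
  set p := s - a • (v - z) with hp
  have hFu := hmin u hu.1
  have hbody : ∀ g : Euc d × Euc d → ℝ≥0∞, lexp (recappBody X approx 2 a (x, v)) g =
      lexp (approx s s x) fun x' => lexp (unbiasedProx approx 2 s x) fun xt =>
        g (x', proj X (v - a⁻¹ • (s - xt))) := by
    intro g
    simp only [recappBody, lexp_bind, lexp_pure, hs]
  rw [hbody]
  have hA := A.lexp_le s s hsX x u hu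
  have hB := A.lexp_unbiasedProx_le H hlam hsX x hu p
  calc _ ≤ lexp (approx s s x) (fun x' => lexp (unbiasedProx approx 2 s x) fun xt =>
          ENNReal.ofReal (1 / a ^ 2 * (2 * proxGap f lam s u x' +
            (objective f u - objective f z + lam / 4 * ‖s - u‖ ^ 2))) +
          ENNReal.ofReal (lam / 2 * (1 / a ^ 2) * ‖xt - p‖ ^ 2)) := by
        refine (A.resultIn s s hsX x).lexp_mono fun x' hx' => lexp_mono _ fun xt => ?_
        have h0 := hu.proxGap_nonneg H hlam.le hx'
        have h1 : 0 ≤ objective f u - objective f z + lam / 4 * ‖s - u‖ ^ 2 := by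
          have : 0 ≤ lam / 4 * ‖s - u‖ ^ 2 := by positivity
          linarith
        rw [← ENNReal.ofReal_add (by positivity) (by positivity)]
        refine ENNReal.ofReal_le_ofReal (add_le_add ?_ ?_)
        · refine mul_le_mul_of_nonneg_left ?_ (by positivity)
          linarith [hu.objective_sub_le hlam.le H hx']
        · have h2 := norm_proj_sub_sq_le ⟨x, hx⟩ H.isClosed H.convex (v - a⁻¹ • (s - xt)) hz.1
          have e : v - a⁻¹ • (s - xt) - z = a⁻¹ • (xt - p) := by
            have : v - z = a⁻¹ • (a • (v - z)) := by rw [inv_smul_smul₀ ha.ne']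
            rw [sub_right_comm, this, ← smul_sub, hp]
            congr 1
            abel
          rw [e, norm_smul, mul_pow, Real.norm_of_nonneg (by positivity), inv_pow,
            ← one_div (a ^ 2)] at h2
          rw [mul_assoc]
          exact mul_le_mul_of_nonneg_left h2 (by positivity)
    _ = lexp (approx s s x) (fun x' => ENNReal.ofReal (1 / a ^ 2 * (2 * proxGap f lam s u x' +
            (objective f u - objective f z + lam / 4 * ‖s - u‖ ^ 2)))) +
          lexp (unbiasedProx approx 2 s x) (fun xt =>
          ENNReal.ofReal (lam / 2 * (1 / a ^ 2) * ‖xt - p‖ ^ 2)) := by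
        simp only [lexp_add, lexp_const]
    _ ≤ ENNReal.ofReal (1 / a ^ 2 * (2 * (1 / 8 * W) +
            (objective f u - objective f z + lam / 4 * ‖s - u‖ ^ 2))) +
          ENNReal.ofReal (lam / 2 * (1 / a ^ 2) * (‖u - p‖ ^ 2 + 3 / (64 * lam) * W)) := by
        have h1 : 0 ≤ objective f u - objective f z + lam / 4 * ‖s - u‖ ^ 2 := by
          have : 0 ≤ lam / 4 * ‖s - u‖ ^ 2 := by positivity
          linarith
        refine add_le_add ?_ ?_
        · rw [lexp_ofReal_mul _ (by positivity), ENNReal.ofReal_mul (by positivity)]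
          gcongr
          rw [lexp_ofReal_add _ (A.resultIn s s hsX x) (fun x' hx' =>
            mul_nonneg zero_le_two (hu.proxGap_nonneg H hlam.le hx')) (fun _ _ => h1), lexp_const,
            ENNReal.ofReal_add (by positivity) h1, lexp_ofReal_mul _ zero_le_two,
            ENNReal.ofReal_mul zero_le_two]
          gcongr
        · rw [lexp_ofReal_mul _ (by positivity),
            ENNReal.ofReal_mul (q := ‖u - p‖ ^ 2 + 3 / (64 * lam) * W) (by positivity)]
          gcongr
    _ ≤ _ := by
        have h1 : 0 ≤ objective f u - objective f z + lam / 4 * ‖s - u‖ ^ 2 := by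
          have : 0 ≤ lam / 4 * ‖s - u‖ ^ 2 := by positivity
          linarith
        rw [← ENNReal.ofReal_add (by positivity) (by positivity)]
        refine ENNReal.ofReal_le_ofReal ?_
        have hF := hu.objective_le H hx hz.1 ha.le (by linarith) hs
        have e1 : ‖u - p‖ ^ 2 = ‖s - u‖ ^ 2 - 2 * (a * inner ℝ (s - u) (v - z)) +
            a ^ 2 * ‖v - z‖ ^ 2 := by
          have : u - p = -((s - u) - a • (v - z)) := by rw [hp]; abel
          rw [this, norm_neg, norm_sub_sq_real, inner_smul_right, norm_smul, mul_pow,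
            Real.norm_of_nonneg ha.le]
        have h2 : 0 ≤ lam * ‖s - u‖ ^ 2 := by positivity
        have h3 := mul_nonneg (show 0 ≤ 62 / 100 - a by linarith) hV
        have e2 : lam * (3 / (64 * lam) * W) = 3 / 64 * W := by
          field_simp
        -- The inner products cancel. The errors add up to `(1/4 + 3/128) W`, whose part in `‖s -
        -- u‖²` is covered by the leftover `lam/4`, and whose part in `V_u(x)` by `1 - a ≥ 38/100`.
        have key : (2 * (1 / 8 * W) + (objective f u - objective f z + lam / 4 * ‖s - u‖ ^ 2)) +
            lam / 2 * (‖u - p‖ ^ 2 + 3 / (64 * lam) * W) ≤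
            (1 - a) * (objective f x - objective f z) + a ^ 2 * (lam / 2 * ‖v - z‖ ^ 2) := by
          rw [mul_add, e1]
          linarith
        have key2 := mul_le_mul_of_nonneg_left key (show 0 ≤ 1 / a ^ 2 by positivity)
        have e3 : 1 / a ^ 2 * ((1 - a) * (objective f x - objective f z) +
            a ^ 2 * (lam / 2 * ‖v - z‖ ^ 2)) =
            (1 - a) / a ^ 2 * (objective f x - objective f z) + lam / 2 * ‖v - z‖ ^ 2 := by
          field_simp
        rw [e3] at key2
        refine le_trans (le_of_eq ?_) key2
        ring

theorem IsApproxProx.resultIn_recappLoop (H : IsFiniteSumProblem X f L R) {lam : ℝ}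
    {approx : Euc d → Euc d → Euc d → QueryM (Euc d)} (A : IsApproxProx X f lam approx)
    (j₀ T : ℕ) {x₀ : Euc d} (hx : x₀ ∈ X) : (recappLoop X approx j₀ T x₀).ResultIn X := by
  rw [recappLoop_eq]
  exact (resultIn_forLoop (S := fun _ => X ×ˢ X) ⟨hx, hx⟩ (fun t w hw =>
    A.resultIn_recappBody H j₀ (alpha_pos _).le (alpha_spec t).2.1.2 hw) T).bind
    fun w hw => resultIn_pure hw.1

/-- The convergence rate of RECAPP. -/
theorem IsApproxProx.lexp_recappLoop_le (H : IsFiniteSumProblem X f L R) {lam : ℝ}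
    (hlam : 0 < lam) {approx : Euc d → Euc d → Euc d → QueryM (Euc d)}
    (A : IsApproxProx X f lam approx) {s₀ z : Euc d} (hz : IsProxPoint X f 0 s₀ z) {x₀ : Euc d}
    (hx : x₀ ∈ X) (T : ℕ) :
    lexp (recappLoop X approx 2 T x₀) (fun x => ENNReal.ofReal (gap X f x)) ≤
      ENNReal.ofReal (4 / ((T : ℝ) + 2) ^ 2 * (gap X f x₀ + lam / 2 * ‖x₀ - z‖ ^ 2)) := by
  have hloop := lexp_forLoop_le (S := fun _ => X ×ˢ X) (b := 0)
    (P := fun t w => ENNReal.ofReal (1 / alpha t ^ 2 * (objective f w.1 - objective f z) +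
      lam / 2 * ‖w.2 - z‖ ^ 2))
    (body := fun t w => recappBody X approx 2 (alpha (t + 1)) w) (init := (x₀, x₀)) ⟨hx, hx⟩
    (fun t w hw => A.resultIn_recappBody H 2 (alpha_pos _).le (alpha_spec t).2.1.2 hw)
    (fun t w hw => by
      rw [add_zero, ← one_sub_alpha_div t]
      exact A.lexp_recappBody_le H hlam hz (alpha_pos _) (alpha_succ_le t) hw) T
  have hres := resultIn_forLoop (S := fun _ => X ×ˢ X)
    (body := fun t w => recappBody X approx 2 (alpha (t + 1)) w) (init := (x₀, x₀)) ⟨hx, hx⟩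
    (fun t w hw => A.resultIn_recappBody H 2 (alpha_pos _).le (alpha_spec t).2.1.2 hw) T
  have ha : alpha 0 = 1 := rfl
  rw [mul_zero, add_zero, ha, one_pow, div_one, one_mul, ← H.gap_eq hz] at hloop
  rw [recappLoop_eq, lexp_bind]
  simp only [lexp_pure]
  have hgap := H.gap_nonneg hx
  rw [ENNReal.ofReal_mul (by positivity)]
  refine le_trans ?_ (mul_le_mul_right hloop _)
  rw [← lexp_const_mul]
  refine hres.lexp_mono fun w hw => ?_
  rw [← ENNReal.ofReal_mul (by positivity)]
  refine ENNReal.ofReal_le_ofReal ?_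
  rw [← H.gap_eq hz]
  have h1 := H.gap_nonneg hw.1
  have hT := le_inv_alpha T
  have h2 : (((T : ℝ) + 2) / 2) ^ 2 ≤ 1 / alpha T ^ 2 := by
    rw [one_div, ← inv_pow]
    gcongr
  rw [div_mul_eq_mul_div, le_div_iff₀ (by positivity)]
  have h3 := mul_le_mul_of_nonneg_right h2 h1
  have h4 : 0 ≤ lam / 2 * ‖w.2 - z‖ ^ 2 := by positivity
  linarith

/-! ### Expected queries of RECAPP -/

theorem tsum_geomHalf_mul_le (b : ℝ≥0∞) : ∑' k, geomHalf k * (k * b) = b := by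
  have h1 : ∑' k, geomHalf k * (k : ℝ≥0∞) = 1 := by
    have hs := (hasSum_coe_mul_geometric_of_norm_lt_one (r := (1 / 2 : ℝ)) (by norm_num)).mul_left
      (1 / 2 : ℝ)
    have e : ∀ k : ℕ, geomHalf k * (k : ℝ≥0∞) =
        ENNReal.ofReal (1 / 2 * (k * (1 / 2 : ℝ) ^ k)) := by
      intro k
      rw [geomHalf_apply, ← ENNReal.ofReal_natCast, ← ENNReal.ofReal_mul (by positivity)]
      congr 1
      ring
    simp only [e]
    rw [← ENNReal.ofReal_tsum_of_nonneg (fun k => by positivity) hs.summable, hs.tsum_eq]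
    norm_num
  simp only [← mul_assoc]
  rw [ENNReal.tsum_mul_right, h1, one_mul]

/-- One initial call, two for the offset, and one on average for the geometric level, whose mean is
`1`. -/
theorem expectedQueries_unbiasedProx_le
    {approx : Euc d → Euc d → Euc d → QueryM (Euc d)} {b : ℝ≥0∞}
    (hb : ∀ s x y, (approx s x y).expectedQueries ≤ b) (s xprev : Euc d) :
    (unbiasedProx approx 2 s xprev).expectedQueries ≤ 4 * b := by
  rw [unbiasedProx_eq]
  have hk : ∀ (k : ℕ) (x0 : Euc d), expectedQueries
      (forLoop (fun _ x => approx s x x) x0 2 >>= fun xj =>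
          pairChain (fun x => approx s x x) xj k >>= fun w =>
            pure (xj + (geomHalf k).toReal⁻¹ • (w.2 - w.1))) ≤ 2 * b + k * b := by
    intro k x0
    refine expectedQueries_bind_le _ _
      (expectedQueries_forLoop_le _ _ 2 fun _ x => hb s x x) fun xj => ?_
    rw [← add_zero ((k : ℝ≥0∞) * b)]
    refine expectedQueries_bind_le _ _ (expectedQueries_forLoop_le _ _ _ fun _ w => ?_)
      fun w => (expectedQueries_pure _).le
    rw [← add_zero b]
    exact expectedQueries_bind_le _ _ (hb _ _ _) fun _ => (expectedQueries_pure _).le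
  have e : 4 * b = b + (2 * b + b) := by ring
  rw [e]
  refine expectedQueries_bind_le _ _ (hb _ _ _) fun x0 => ?_
  rw [expectedQueries_bind, expectedQueries_sample, zero_add, lexp_sample]
  refine (ENNReal.tsum_le_tsum fun k => mul_le_mul_right (hk k x0) _).trans ?_
  simp only [mul_add, ENNReal.tsum_add]
  rw [tsum_geomHalf_mul_le, ENNReal.tsum_mul_right, PMF.tsum_coe, one_mul]

theorem expectedQueries_recappLoop_le (X : Set (Euc d))
    {approx : Euc d → Euc d → Euc d → QueryM (Euc d)} {b : ℝ≥0∞}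
    (hb : ∀ s x y, (approx s x y).expectedQueries ≤ b) (T : ℕ) (x₀ : Euc d) :
    (recappLoop X approx 2 T x₀).expectedQueries ≤ T * (5 * b) := by
  rw [recappLoop_eq, ← add_zero ((T : ℝ≥0∞) * (5 * b))]
  refine expectedQueries_bind_le _ _ (expectedQueries_forLoop_le _ _ _ fun t z => ?_)
    fun z => (expectedQueries_pure _).le
  have e : 5 * b = b + (4 * b + 0) := by ring
  rw [e]
  exact expectedQueries_bind_le _ _ (hb _ _ _) fun _ => expectedQueries_bind_le _ _
    (expectedQueries_unbiasedProx_le hb _ _) fun _ => (expectedQueries_pure _).le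

theorem expectedQueries_approxProxSvrg_le [NeZero n] (X : Set (Euc d))
    (f : Fin n → Euc d → ℝ) (hL : 0 < L) (s x y : Euc d) :
    (approxProxSvrg X (gradOracle f) L (L / n) s x y).expectedQueries ≤ 2049 * n := by
  rw [approxProxSvrg_eq X f hL]
  refine (expectedQueries_oneEpochSvrg_le _ _ _ _ _ _).trans_eq ?_
  push_cast
  ring

/-! ### The warm start -/

theorem IsFiniteSumProblem.bregObj_le_gap (H : IsFiniteSumProblem X f L R) {s z x : Euc d}
    (hz : IsProxPoint X f 0 s z) (hx : x ∈ X) : bregObj f z x ≤ gap X f x := by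
  have h := hz.bregObj_le_proxGap le_rfl hx
  rw [proxGap] at h
  rw [H.gap_eq hz]
  linarith

theorem resultIn_warmStartSvrg [NeZero n] (H : IsFiniteSumProblem X f L R) {T : ℕ} (hT : 0 < T)
    (K : ℕ) {x : Euc d} (hx : x ∈ X) :
    (warmStartSvrg X (gradOracle f) L T K x).ResultIn X :=
  resultIn_forLoop (S := fun _ => X) hx
    (fun _ y hy => resultIn_oneEpochSvrg H _ y hy _ hT) K

/-- One epoch of the warm start with step size `1 / (8 L m)`. -/
theorem lexp_warmStart_epoch_le [NeZero n] (H : IsFiniteSumProblem X f L R) (hL : 0 < L)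
    {s z x : Euc d} (hz : IsProxPoint X f 0 s z) (hx : x ∈ X) {m : ℝ} (hm : 1 ≤ m) :
    lexp (oneEpochSvrg X (gradOracle f) x x (8 * L * m)⁻¹ (32 * n))
      (fun y => ENNReal.ofReal (gap X f y)) ≤
    ENNReal.ofReal (7 / 40 * (L * R ^ 2 * m / n)) +
      ENNReal.ofReal (33 / 80 * m⁻¹) * ENNReal.ofReal (bregObj f z x) := by
  have hn : (0 : ℝ) < n := Nat.cast_pos.2 (NeZero.pos n)
  have hm0 : 0 < m := by linarith
  have hV := H.bregObj_nonneg z x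
  have hfun : (fun y => ENNReal.ofReal (gap X f y)) =
      fun y => ENNReal.ofReal (proxGap f 0 s z y) := by
    funext y
    rw [H.gap_eq hz, proxGap]
    simp
  have hc : 2 / 7 * m⁻¹ = 16 / 7 * ((8 * L * m)⁻¹ * L) := by
    field_simp
    norm_num
  have hmi : m⁻¹ ≤ 1 := inv_le_one_of_one_le₀ hm
  rw [hfun, gradOracle_eq_detOracle f s]
  refine (lexp_oneEpochSvrg_le H hL le_rfl (by positivity) ?_ hz x hx
    (by have := NeZero.pos n; positivity) hc).trans ?_
  · rw [add_zero, mul_inv_rev, mul_inv_rev]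
    have : m⁻¹ * (L⁻¹ * 8⁻¹) * L = m⁻¹ / 8 := by field_simp
    rw [this]
    linarith
  · rw [← ENNReal.ofReal_mul (by positivity), ← ENNReal.ofReal_add (by positivity) (by positivity)]
    refine ENNReal.ofReal_le_ofReal ?_
    have hk : 0 < 1 - 2 / 7 * m⁻¹ := by linarith
    have hn1 : (1 : ℝ) ≤ n := Nat.one_le_cast.2 (NeZero.pos n)
    have hR : ‖x - z‖ ^ 2 ≤ R ^ 2 := by
      have := H.diam_le x hx z hz.1
      gcongr
    push_cast
    rw [inv_mul_le_iff₀ (mul_pos hk (by positivity))]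
    have e1 : (2 * (8 * L * m)⁻¹)⁻¹ = 4 * L * m := by field_simp; norm_num
    rw [e1]
    set V := bregObj f z x
    have h1 : 4 * L * m * ‖x - z‖ ^ 2 ≤ 4 * L * m * R ^ 2 := by gcongr
    have hB : 0 ≤ 7 / 40 * (L * R ^ 2 * m / n) + 33 / 80 * m⁻¹ * V := by positivity
    -- Here `c = 2/7 m⁻¹ ≤ 2/7`, hence `1 - c ≥ 5/7`. The constants come from `5/7 · 32 · 7/40 = 4`
    -- and `5/7 · 32 · 33/80 = 66/7 = 2/7 · 33`, the last factor covering `32 n + 1 ≤ 33 n`.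
    have h2 : 5 / 7 * (32 * n) * (7 / 40 * (L * R ^ 2 * m / n) + 33 / 80 * m⁻¹ * V) ≤
        (1 - 2 / 7 * m⁻¹) * (32 * n) * (7 / 40 * (L * R ^ 2 * m / n) + 33 / 80 * m⁻¹ * V) := by
      gcongr
      linarith
    have e2 : 5 / 7 * (32 * n) * (7 / 40 * (L * R ^ 2 * m / n) + 33 / 80 * m⁻¹ * V) =
        4 * L * m * R ^ 2 + 66 / 7 * (n * (m⁻¹ * V)) := by
      field_simp
      ring
    have h3 : m⁻¹ * V ≤ n * (m⁻¹ * V) := le_mul_of_one_le_left (by positivity) hn1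
    linarith

theorem sq_rpow_half_pow {a : ℝ} (ha : 0 ≤ a) (k : ℕ) :
    (a ^ ((1 / 2 : ℝ) ^ (k + 1))) ^ 2 = a ^ ((1 / 2 : ℝ) ^ k) := by
  rw [← Real.rpow_natCast, ← Real.rpow_mul ha]
  congr 1
  rw [pow_succ]
  push_cast
  ring

/-- The previous scale is `m²`, so the epoch bound `7/40 m + 33/80 m⁻¹ · m²/2` is at most `m/2`. The
hypothesis concerns the Bregman divergence because the initial gap is not bounded by `L R²` on a
constrained set, whereas the divergence is. -/
theorem lexp_warmStartSvrg_bregObj_le [NeZero n] (H : IsFiniteSumProblem X f L R) (hL : 0 < L)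
    {s z x : Euc d} (hz : IsProxPoint X f 0 s z) (hx : x ∈ X) (k : ℕ)
    (hk : lexp (warmStartSvrg X (gradOracle f) L (32 * n) k x)
      (fun y => ENNReal.ofReal (bregObj f z y)) ≤
        ENNReal.ofReal (1 / 2 * (L * R ^ 2 * (n : ℝ) ^ ((1 / 2 : ℝ) ^ k) / n))) :
    lexp (warmStartSvrg X (gradOracle f) L (32 * n) (k + 1) x)
      (fun y => ENNReal.ofReal (gap X f y)) ≤
        ENNReal.ofReal (1 / 2 * (L * R ^ 2 * (n : ℝ) ^ ((1 / 2 : ℝ) ^ (k + 1)) / n)) := by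
  have hn : (0 : ℝ) < n := Nat.cast_pos.2 (NeZero.pos n)
  have hn1 : (1 : ℝ) ≤ n := Nat.one_le_cast.2 (NeZero.pos n)
  set m := (n : ℝ) ^ ((1 / 2 : ℝ) ^ (k + 1)) with hmdef
  have hm : 1 ≤ m := Real.one_le_rpow hn1 (by positivity)
  have hm0 : 0 < m := by linarith
  rw [warmStartSvrg, lexp_forLoop_succ]
  refine ((resultIn_warmStartSvrg H (by have := NeZero.pos n; positivity) k hx).lexp_mono
    fun y hy => lexp_warmStart_epoch_le H hL hz hy hm).trans ?_
  rw [lexp_add, lexp_const, lexp_const_mul]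
  rw [← sq_rpow_half_pow hn.le, ← hmdef] at hk
  refine (add_le_add_right (mul_le_mul_right hk _) _).trans ?_
  rw [← ENNReal.ofReal_mul (by positivity), ← ENNReal.ofReal_add (by positivity) (by positivity)]
  refine ENNReal.ofReal_le_ofReal ?_
  have e : 33 / 80 * m⁻¹ * (1 / 2 * (L * R ^ 2 * m ^ 2 / n)) =
      33 / 160 * (L * R ^ 2 * m / n) := by
    field_simp
    ring
  rw [e]
  have : 0 ≤ L * R ^ 2 * m / n := by positivity
  linarith

theorem lexp_warmStartSvrg_succ_le [NeZero n] (H : IsFiniteSumProblem X f L R) (hL : 0 < L)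
    {x : Euc d} (hx : x ∈ X) (k : ℕ) :
    lexp (warmStartSvrg X (gradOracle f) L (32 * n) (k + 1) x)
      (fun y => ENNReal.ofReal (gap X f y)) ≤
        ENNReal.ofReal (1 / 2 * (L * R ^ 2 * (n : ℝ) ^ ((1 / 2 : ℝ) ^ (k + 1)) / n)) := by
  have hn : (0 : ℝ) < n := Nat.cast_pos.2 (NeZero.pos n)
  obtain ⟨z, hz⟩ := H.exists_isProxPoint ⟨x, hx⟩ 0 0
  refine lexp_warmStartSvrg_bregObj_le H hL hz hx k ?_
  induction k with
  | zero =>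
    simp only [warmStartSvrg, forLoop, lexp_pure]
    refine ENNReal.ofReal_le_ofReal ((H.bregObj_le z x).trans ?_)
    have hR : ‖x - z‖ ^ 2 ≤ R ^ 2 := by
      have := H.diam_le x hx z hz.1
      gcongr
    rw [pow_zero, Real.rpow_one, mul_div_cancel_right₀ _ hn.ne', div_mul_eq_mul_div,
      one_div_mul_eq_div]
    gcongr
  | succ k ih =>
    exact ((resultIn_warmStartSvrg H (by have := NeZero.pos n; positivity) _ hx).lexp_mono
      fun y hy => ENNReal.ofReal_le_ofReal (H.bregObj_le_gap hz hy)).trans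
      (lexp_warmStartSvrg_bregObj_le H hL hz hx k ih)

/-- The double ceiling gives `n ≤ 2^(2^K)`, and the additional epoch brings the exponent to `1/2`,
so the power is at most `√2`. -/
theorem rpow_warmStartEpochs_le {n : ℕ} :
    (n : ℝ) ^ ((1 / 2 : ℝ) ^ warmStartEpochs n) ≤ 3 / 2 := by
  rw [warmStartEpochs]
  set K := Nat.clog 2 (Nat.clog 2 n)
  have h1 : n ≤ 2 ^ (2 ^ K) := (Nat.le_pow_clog one_lt_two n).trans
    (Nat.pow_le_pow_right two_pos (Nat.le_pow_clog one_lt_two _))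
  have h2 : (n : ℝ) ≤ 2 ^ (2 ^ K) := by exact_mod_cast h1
  have h3 : (n : ℝ) ^ ((1 / 2 : ℝ) ^ (K + 1)) ≤ (2 ^ (2 ^ K)) ^ ((1 / 2 : ℝ) ^ (K + 1)) :=
    Real.rpow_le_rpow (by positivity) h2 (by positivity)
  refine h3.trans ?_
  rw [← Real.rpow_natCast, ← Real.rpow_mul zero_le_two]
  have e : ((2 ^ K : ℕ) : ℝ) * (1 / 2) ^ (K + 1) = 1 / 2 := by
    push_cast
    rw [pow_succ, ← mul_assoc, ← mul_pow]
    norm_num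
  rw [e, ← Real.sqrt_eq_rpow]
  exact Real.sqrt_le_iff.2 ⟨by norm_num, by norm_num⟩

/-- The guarantee of the warm start. -/
theorem lexp_warmStart_le [NeZero n] (H : IsFiniteSumProblem X f L R) (hL : 0 < L)
    {x : Euc d} (hx : x ∈ X) :
    lexp (warmStartSvrg X (gradOracle f) L (32 * n) (warmStartEpochs n) x)
      (fun y => ENNReal.ofReal (gap X f y)) ≤ ENNReal.ofReal (3 / 4 * (L * R ^ 2 / n)) := by
  refine (lexp_warmStartSvrg_succ_le H hL hx _).trans (ENNReal.ofReal_le_ofReal ?_)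
  have h : (n : ℝ) ^ ((1 / 2 : ℝ) ^ (Nat.clog 2 (Nat.clog 2 n) + 1)) ≤ 3 / 2 :=
    rpow_warmStartEpochs_le
  have h2 := mul_le_mul_of_nonneg_left h (show 0 ≤ L * R ^ 2 / n by positivity)
  have e : L * R ^ 2 * (n : ℝ) ^ ((1 / 2 : ℝ) ^ (Nat.clog 2 (Nat.clog 2 n) + 1)) / n =
      L * R ^ 2 / n * (n : ℝ) ^ ((1 / 2 : ℝ) ^ (Nat.clog 2 (Nat.clog 2 n) + 1)) := by ring
  rw [e]
  linarith

theorem warmStartEpochs_le (n : ℕ) :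
    (warmStartEpochs n : ℝ) ≤ 6 * max 1 (Real.log (Real.log n)) := by
  have hmax1 := le_max_left 1 (Real.log (Real.log n))
  have hmax2 := le_max_right 1 (Real.log (Real.log n))
  rw [warmStartEpochs]
  rcases Nat.eq_zero_or_pos (Nat.clog 2 (Nat.clog 2 n)) with h0 | h0
  · rw [h0]
    push_cast
    linarith
  obtain ⟨k, hk⟩ := Nat.exists_eq_succ_of_ne_zero h0.ne'
  have hc2 : 1 < Nat.clog 2 n := by
    by_contra hle
    rw [Nat.clog_of_right_le_one (not_lt.1 hle)] at h0
    exact lt_irrefl _ h0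
  have hn2 : 1 < n := by
    by_contra hle
    rw [Nat.clog_of_right_le_one (not_lt.1 hle)] at hc2
    omega
  have h1 := Nat.pow_pred_clog_lt_self one_lt_two hc2
  rw [hk, Nat.pred_succ] at h1
  have h2 := Nat.pow_pred_clog_lt_self one_lt_two hn2
  have h3 : 2 ^ (2 ^ k) < n :=
    (Nat.pow_le_pow_right two_pos (by rw [Nat.pred_eq_sub_one]; omega)).trans_lt h2
  -- Minimality of both ceilings yields `2^(2^k) < n` for `k + 1` in place of the double ceiling;
  -- two logarithms then bound `k` by `2 log log n` plus a constant.
  have h4 : (2 : ℝ) ^ (2 ^ k) ≤ n := by exact_mod_cast h3.le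
  have hlog2 : (1 / 2 : ℝ) ≤ Real.log 2 := by linarith [Real.log_two_gt_d9]
  have h5 : (2 : ℝ) ^ k * (1 / 2) ≤ Real.log n := by
    have := Real.log_le_log (by positivity) h4
    rw [Real.log_pow] at this
    push_cast at this
    nlinarith [show (0 : ℝ) ≤ 2 ^ k by positivity]
  have h6 := Real.log_le_log (by positivity) h5
  rw [Real.log_mul (by positivity) (by norm_num), Real.log_pow, one_div, Real.log_inv] at h6
  have h7 : (k : ℝ) * (1 / 2) ≤ k * Real.log 2 := by gcongr
  rw [hk]
  push_cast
  have h8 : Real.log 2 ≤ 3 / 4 := by linarith [Real.log_two_lt_d9]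
  linarith

theorem expectedQueries_warmStart_le [NeZero n] (X : Set (Euc d)) (f : Fin n → Euc d → ℝ)
    (L : ℝ) (K : ℕ) (x : Euc d) :
    (warmStartSvrg X (gradOracle f) L (32 * n) K x).expectedQueries ≤ K * (65 * n) := by
  refine expectedQueries_forLoop_le _ _ _ fun k y => ?_
  rw [gradOracle_eq_detOracle f 0]
  refine (expectedQueries_oneEpochSvrg_le _ _ _ _ _ _).trans_eq ?_
  push_cast
  ring

/-! ### RECAPP and restarted RECAPP for finite sums -/

theorem recappSvrg_eq [NeZero n] (X : Set (Euc d)) (f : Fin n → Euc d → ℝ) (L : ℝ)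
    (xinit : Euc d) (T : ℕ) :
    recappSvrg X f L xinit T =
      (warmStartSvrg X (gradOracle f) L (32 * n) (warmStartEpochs n) xinit >>=
        recappLoop X (approxProxSvrg X (gradOracle f) L (L / n)) 2 T) := rfl

theorem restartedRecappSvrg_eq [NeZero n] (X : Set (Euc d)) (f : Fin n → Euc d → ℝ) (L : ℝ)
    (xinit : Euc d) (T K : ℕ) :
    restartedRecappSvrg X f L xinit T K =
      (warmStartSvrg X (gradOracle f) L (32 * n) (warmStartEpochs n) xinit >>= fun x0 =>
        forLoop (fun _ x => recappLoop X (approxProxSvrg X (gradOracle f) L (L / n)) 2 T x)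
          x0 K) := rfl

theorem resultIn_warmStart [NeZero n] (H : IsFiniteSumProblem X f L R) {x : Euc d} (hx : x ∈ X) :
    (warmStartSvrg X (gradOracle f) L (32 * n) (warmStartEpochs n) x).ResultIn X :=
  resultIn_warmStartSvrg H (by have := NeZero.pos n; positivity) _ hx

theorem resultIn_recappSvrg [NeZero n] (H : IsFiniteSumProblem X f L R) (hL : 0 < L)
    {xinit : Euc d} (hx : xinit ∈ X) (T : ℕ) : (recappSvrg X f L xinit T).ResultIn X := by
  rw [recappSvrg_eq]
  exact (resultIn_warmStart H hx).bind fun x0 hx0 =>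
    (isApproxProx_approxProxSvrg H hL).resultIn_recappLoop H 2 T hx0

theorem resultIn_restartedRecappSvrg [NeZero n] (H : IsFiniteSumProblem X f L R) (hL : 0 < L)
    {xinit : Euc d} (hx : xinit ∈ X) (T K : ℕ) :
    (restartedRecappSvrg X f L xinit T K).ResultIn X := by
  rw [restartedRecappSvrg_eq]
  exact (resultIn_warmStart H hx).bind fun x0 hx0 => resultIn_forLoop (S := fun _ => X) hx0
    (fun _ x hx => (isApproxProx_approxProxSvrg H hL).resultIn_recappLoop H 2 T hx) K

theorem expectation_recappSvrg_le [NeZero n] (H : IsFiniteSumProblem X f L R) (hL : 0 < L)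
    {xinit : Euc d} (hx : xinit ∈ X) (T : ℕ) :
    (recappSvrg X f L xinit T).expectation (gap X f) ≤
      ENNReal.ofReal (5 * (L * R ^ 2 / n) / ((T : ℝ) + 2) ^ 2) := by
  have hn : (0 : ℝ) < n := Nat.cast_pos.2 (NeZero.pos n)
  obtain ⟨z, hz⟩ := H.exists_isProxPoint ⟨xinit, hx⟩ 0 0
  have hres := resultIn_warmStart H hx
  rw [expectation_eq_lexp, recappSvrg_eq, lexp_bind]
  refine (hres.lexp_mono (h := fun x => ENNReal.ofReal (4 / ((T : ℝ) + 2) ^ 2) *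
    (ENNReal.ofReal (gap X f x) + ENNReal.ofReal (1 / 2 * (L * R ^ 2 / n)))) fun x hx => ?_).trans ?_
  · refine ((isApproxProx_approxProxSvrg H hL).lexp_recappLoop_le H (by positivity) hz hx T).trans ?_
    rw [← ENNReal.ofReal_add (H.gap_nonneg hx) (by positivity),
      ← ENNReal.ofReal_mul (by positivity)]
    refine ENNReal.ofReal_le_ofReal (mul_le_mul_of_nonneg_left ?_ (by positivity))
    have hR : ‖x - z‖ ^ 2 ≤ R ^ 2 := by
      have := H.diam_le x hx z hz.1
      gcongr
    have h1 := mul_le_mul_of_nonneg_left hR (show 0 ≤ L / n / 2 by positivity)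
    have e : L / n / 2 * R ^ 2 = 1 / 2 * (L * R ^ 2 / n) := by ring
    linarith
  · rw [lexp_const_mul, lexp_add, lexp_const]
    refine (mul_le_mul_right (add_le_add_left (lexp_warmStart_le H hL hx) _) _).trans ?_
    rw [← ENNReal.ofReal_add (by positivity) (by positivity), ← ENNReal.ofReal_mul (by positivity)]
    refine ENNReal.ofReal_le_ofReal (le_of_eq ?_)
    ring

/-- One run of RECAPP on a strongly convex problem. -/
theorem lexp_recappLoop_strongConvex_le [NeZero n] (H : IsFiniteSumProblem X f L R) (hL : 0 < L)
    {γ : ℝ} (hγ : 0 < γ) (hF : StrongConvexOn X γ (objective f)) {T : ℕ}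
    (hT : 8 * (1 + L / (n * γ)) ≤ (T : ℝ) ^ 2) {x : Euc d} (hx : x ∈ X) :
    lexp (recappLoop X (approxProxSvrg X (gradOracle f) L (L / n)) 2 T x)
      (fun y => ENNReal.ofReal (gap X f y)) ≤
    ENNReal.ofReal (1 / 2) * ENNReal.ofReal (gap X f x) := by
  have hn : (0 : ℝ) < n := Nat.cast_pos.2 (NeZero.pos n)
  obtain ⟨z, hz⟩ := H.exists_isProxPoint ⟨x, hx⟩ 0 0
  have hg := H.gap_nonneg hx
  have hd := H.sq_dist_le_gap hF hz hx
  rw [← ENNReal.ofReal_mul (by norm_num)]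
  refine ((isApproxProx_approxProxSvrg H hL).lexp_recappLoop_le H (by positivity) hz hx T).trans
    (ENNReal.ofReal_le_ofReal ?_)
  have h1 : L / n / 2 * ‖x - z‖ ^ 2 ≤ L / (n * γ) * gap X f x := by
    have := mul_le_mul_of_nonneg_left hd (show 0 ≤ L / (n * γ) by positivity)
    refine le_trans (le_of_eq ?_) this
    field_simp
  -- Quadratic growth bounds the distance term by `L/(nγ)` times the gap, so the rate `4/(T + 2)²`
  -- halves the gap as soon as `(T + 2)² ≥ 8 (1 + L/(nγ))`.
  have hT2 : 8 * (1 + L / (n * γ)) ≤ ((T : ℝ) + 2) ^ 2 := by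
    have : (0 : ℝ) ≤ T := Nat.cast_nonneg T
    nlinarith
  rw [div_mul_eq_mul_div, div_le_iff₀ (by positivity)]
  have h2 := mul_le_mul_of_nonneg_right hT2 hg
  linarith

theorem expectation_restartedRecappSvrg_le [NeZero n] (H : IsFiniteSumProblem X f L R)
    (hL : 0 < L) {γ : ℝ} (hγ : 0 < γ) (hF : StrongConvexOn X γ (objective f)) {T : ℕ}
    (hT : 8 * (1 + L / (n * γ)) ≤ (T : ℝ) ^ 2) {xinit : Euc d} (hx : xinit ∈ X) (K : ℕ) :
    (restartedRecappSvrg X f L xinit T K).expectation (gap X f) ≤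
      ENNReal.ofReal ((1 / 2) ^ K * (3 / 4 * (L * R ^ 2 / n))) := by
  have hres := resultIn_warmStart H hx
  rw [expectation_eq_lexp, restartedRecappSvrg_eq, lexp_bind]
  refine (hres.lexp_mono fun x hx => lexp_forLoop_le_pow (S := X)
    (P := fun y => ENNReal.ofReal (gap X f y)) hx
    (fun _ y hy => (isApproxProx_approxProxSvrg H hL).resultIn_recappLoop H 2 T hy)
    (fun _ y hy => lexp_recappLoop_strongConvex_le H hL hγ hF hT hy) K).trans ?_
  rw [lexp_const_mul, ENNReal.ofReal_mul (by positivity), ENNReal.ofReal_pow (by norm_num)]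
  exact mul_le_mul_right (lexp_warmStart_le H hL hx) _

theorem expectedQueries_recappSvrg_le [NeZero n] (X : Set (Euc d)) (f : Fin n → Euc d → ℝ)
    (hL : 0 < L) (xinit : Euc d) (T : ℕ) :
    (recappSvrg X f L xinit T).expectedQueries ≤
      ENNReal.ofReal (390 * (n * max 1 (Real.log (Real.log n))) + 10245 * (n * T)) := by
  rw [recappSvrg_eq]
  refine (expectedQueries_bind_le _ _ (expectedQueries_warmStart_le X f L _ xinit) fun x =>
    expectedQueries_recappLoop_le X (expectedQueries_approxProxSvrg_le X f hL) T x).trans ?_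
  have e : (warmStartEpochs n : ℝ≥0∞) * (65 * n) + T * (5 * (2049 * n)) =
      ((warmStartEpochs n * (65 * n) + T * (5 * (2049 * n)) : ℕ) : ℝ≥0∞) := by push_cast; rfl
  rw [e, ← ENNReal.ofReal_natCast]
  refine ENNReal.ofReal_le_ofReal ?_
  push_cast
  have h := mul_le_mul_of_nonneg_right (warmStartEpochs_le n) (show (0 : ℝ) ≤ 65 * n by positivity)
  linarith

theorem expectedQueries_restartedRecappSvrg_le [NeZero n] (X : Set (Euc d))
    (f : Fin n → Euc d → ℝ) (hL : 0 < L) (xinit : Euc d) (T K : ℕ) :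
    (restartedRecappSvrg X f L xinit T K).expectedQueries ≤
      ENNReal.ofReal (390 * (n * max 1 (Real.log (Real.log n))) + 10245 * (n * T * K)) := by
  rw [restartedRecappSvrg_eq]
  refine (expectedQueries_bind_le _ _ (expectedQueries_warmStart_le X f L _ xinit) fun x =>
    expectedQueries_forLoop_le _ _ _ fun _ y =>
    expectedQueries_recappLoop_le X (expectedQueries_approxProxSvrg_le X f hL) T y).trans ?_
  have e : (warmStartEpochs n : ℝ≥0∞) * (65 * n) + K * (T * (5 * (2049 * n))) =
      ((warmStartEpochs n * (65 * n) + K * (T * (5 * (2049 * n))) : ℕ) : ℝ≥0∞) := by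
    push_cast; rfl
  rw [e, ← ENNReal.ofReal_natCast]
  refine ENNReal.ofReal_le_ofReal ?_
  push_cast
  have h := mul_le_mul_of_nonneg_right (warmStartEpochs_le n) (show (0 : ℝ) ≤ 65 * n by positivity)
  linarith

/-! ### Choice of the iteration counts. -/

theorem recapp_convex_rate :
    ∃ C : ℝ, 0 < C ∧
      ∀ (n : ℕ) [NeZero n] (L R ε : ℝ), 0 < L → 0 ≤ R → 0 < ε →
        ∃ T : ℕ, (T : ℝ) ≤ C * (R * √(L / (n * ε))) ∧
          ∀ (d : ℕ) (X : Set (Euc d)) (f : Fin n → Euc d → ℝ),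
            IsFiniteSumProblem X f L R →
            ∀ xinit ∈ X,
              (recappSvrg X f L xinit T).ResultIn X ∧
              (recappSvrg X f L xinit T).expectation (gap X f) ≤ ENNReal.ofReal ε ∧
              (recappSvrg X f L xinit T).expectedQueries ≤ ENNReal.ofReal
                (C * (n * max 1 (Real.log (Real.log n)) + √(n * L * R ^ 2 / ε))) := by
  refine ⟨30735, by norm_num, fun n _ L R ε hL hR hε => ?_⟩
  have hn : (0 : ℝ) < n := Nat.cast_pos.2 (NeZero.pos n)
  set ξ := R * √(L / (n * ε)) with hξ
  have hξ0 : 0 ≤ ξ := by positivity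
  have hT := Nat.floor_le (show 0 ≤ 3 * ξ by positivity)
  have hT2 := Nat.lt_floor_add_one (3 * ξ)
  -- The bound on `T` has no additive constant, so the count is rounded down and may be `0`; the
  -- shift in `(T + 2)²` makes up for it, since `T + 2 > 3ξ`. The constant is `30735 = 3 · 10245`.
  refine ⟨⌊3 * ξ⌋₊, by linarith, fun d X f H xinit hx => ⟨resultIn_recappSvrg H hL hx _, ?_, ?_⟩⟩
  · refine (expectation_recappSvrg_le H hL hx _).trans (ENNReal.ofReal_le_ofReal ?_)
    rw [div_le_iff₀ (by positivity)]
    have h1 : ξ ^ 2 * ε = L * R ^ 2 / n := by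
      rw [hξ, mul_pow, Real.sq_sqrt (by positivity)]
      field_simp
    have h2 : 5 * ξ ^ 2 ≤ ((⌊3 * ξ⌋₊ : ℝ) + 2) ^ 2 := by nlinarith
    have h3 := mul_le_mul_of_nonneg_left h2 hε.le
    linarith
  · refine (expectedQueries_recappSvrg_le X f hL xinit _).trans (ENNReal.ofReal_le_ofReal ?_)
    have h1 : n * ξ = √(n * L * R ^ 2 / ε) := by
      rw [eq_comm, Real.sqrt_eq_iff_mul_self_eq (by positivity) (by positivity), ← sq, mul_pow, hξ,
        mul_pow, Real.sq_sqrt (by positivity)]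
      field_simp
    rw [← h1]
    have h2 := mul_le_mul_of_nonneg_left hT hn.le
    have h3 : 0 ≤ n * max 1 (Real.log (Real.log n)) := by positivity
    linarith

theorem recapp_strongConvex_rate :
    ∀ c : ℝ, 0 < c → ∃ C : ℝ, 0 < C ∧
      ∀ (n : ℕ) [NeZero n] (L R ε γ : ℝ), 0 < L → 0 ≤ R → 0 < ε → 0 < γ → γ ≤ c * (L / n) →
        ∃ T K : ℕ,
          ∀ (d : ℕ) (X : Set (Euc d)) (f : Fin n → Euc d → ℝ),
            IsFiniteSumProblem X f L R →
            StrongConvexOn X γ (objective f) →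
            ∀ xinit ∈ X,
              (restartedRecappSvrg X f L xinit T K).ResultIn X ∧
              (restartedRecappSvrg X f L xinit T K).expectation (gap X f) ≤ ENNReal.ofReal ε ∧
              (restartedRecappSvrg X f L xinit T K).expectedQueries ≤ ENNReal.ofReal
                (C * (n * max 1 (Real.log (Real.log n))
                  + √(n * L / γ) * max 0 (Real.log (L * R ^ 2 / (n * ε))))) := by
  intro c hc
  set D := 4 * √(1 + c) + √c with hD
  have hD0 : 0 < D := by positivity
  refine ⟨390 + 61470 * D, by positivity, fun n _ L R ε γ hL hR hε hγ hγc => ?_⟩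
  have hn : (0 : ℝ) < n := Nat.cast_pos.2 (NeZero.pos n)
  set κ := L / (n * γ) with hκ
  have hκ0 : 0 < κ := by positivity
  have hcκ : 1 ≤ c * κ := by
    have e : c * κ = c * (L / n) / γ := by rw [hκ]; field_simp
    rw [e, one_le_div hγ]
    exact hγc
  set q := L * R ^ 2 / (n * ε) with hq
  have hqε : L * R ^ 2 / n = q * ε := by rw [hq]; field_simp
  have hq0 : 0 ≤ q := by positivity
  -- For `q ≤ 4/3` the warm start alone reaches accuracy `ε`. Otherwise `log q ≥ 1/4`, so the `1`
  -- lost in rounding up is at most `4 log q`.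
  obtain ⟨K, hK1, hK2⟩ : ∃ K : ℕ, 3 / 4 * q ≤ 2 ^ K ∧ (K : ℝ) ≤ 6 * max 0 (Real.log q) := by
    rcases le_or_gt q (4 / 3) with h | h
    · exact ⟨0, by norm_num; linarith, by simp⟩
    · have hlog2 : (1 / 2 : ℝ) ≤ Real.log 2 := by linarith [Real.log_two_gt_d9]
      have hq1 : 0 < q := by linarith
      have hlq : 1 / 4 ≤ Real.log q := by
        have h1 := Real.one_sub_inv_le_log_of_pos hq1
        have h2 : q⁻¹ ≤ 3 / 4 := by
          rw [inv_le_comm₀ hq1 (by norm_num)]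
          linarith
        linarith
      refine ⟨⌈Real.log q / Real.log 2⌉₊, ?_, ?_⟩
      · have h1 : Real.log q / Real.log 2 ≤ ⌈Real.log q / Real.log 2⌉₊ := Nat.le_ceil _
        rw [div_le_iff₀ (by linarith), ← Real.log_pow, Real.log_le_log_iff hq1 (by positivity)]
          at h1
        linarith
      · have h1 := Nat.ceil_lt_add_one (show 0 ≤ Real.log q / Real.log 2 by
          exact div_nonneg (by linarith) (by linarith))
        have h2 : Real.log q / Real.log 2 ≤ 2 * Real.log q := by
          rw [div_le_iff₀ (by linarith)]
          nlinarith
        rw [max_eq_right (by linarith)]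
        linarith
  have hT1 := Nat.le_ceil (4 * √((1 + c) * κ))
  have hT2 := Nat.ceil_lt_add_one (show 0 ≤ 4 * √((1 + c) * κ) by positivity)
  set T := ⌈4 * √((1 + c) * κ)⌉₊
  -- From `1 ≤ c κ` the term `16 (1 + c) κ` dominates `8 (1 + κ)`. The same inequality absorbs the
  -- rounding of `T` into `√c √κ`, which explains the shape of `D`.
  have hT3 : 8 * (1 + L / (n * γ)) ≤ (T : ℝ) ^ 2 := by
    have h1 : (4 * √((1 + c) * κ)) ^ 2 ≤ (T : ℝ) ^ 2 := by gcongr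
    rw [mul_pow, Real.sq_sqrt (by positivity)] at h1
    rw [← hκ]
    linarith
  have hT4 : (T : ℝ) ≤ D * √κ := by
    have h1 : 1 ≤ √c * √κ := by
      rw [← Real.sqrt_mul hc.le]
      exact Real.one_le_sqrt.2 hcκ
    rw [Real.sqrt_mul (by positivity)] at hT2
    rw [hD]
    linarith
  refine ⟨T, K, fun d X f H hF xinit hx => ⟨resultIn_restartedRecappSvrg H hL hx _ _, ?_, ?_⟩⟩
  · refine (expectation_restartedRecappSvrg_le H hL hγ hF hT3 hx K).trans
      (ENNReal.ofReal_le_ofReal ?_)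
    rw [hqε, one_div, inv_pow, inv_mul_le_iff₀ (by positivity)]
    have := mul_le_mul_of_nonneg_right hK1 hε.le
    linarith
  · refine (expectedQueries_restartedRecappSvrg_le X f hL xinit _ _).trans
      (ENNReal.ofReal_le_ofReal ?_)
    have h1 : n * √κ = √(n * L / γ) := by
      rw [eq_comm, Real.sqrt_eq_iff_mul_self_eq (by positivity) (by positivity), ← sq, mul_pow,
        Real.sq_sqrt (by positivity), hκ]
      field_simp
    have h2 : (T : ℝ) * K ≤ D * √κ * (6 * max 0 (Real.log q)) := by gcongr
    have h3 := mul_le_mul_of_nonneg_left h2 hn.le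
    rw [← h1]
    have h4 : 0 ≤ D * (n * max 1 (Real.log (Real.log n))) := by positivity
    have h5 : 0 ≤ n * √κ * max 0 (Real.log q) := by positivity
    linarith

end Recapp

end

theorem mainTheorem2 :
    (∃ C : ℝ, 0 < C ∧
      ∀ (n : ℕ) [NeZero n] (L R ε : ℝ), 0 < L → 0 ≤ R → 0 < ε →
        ∃ T : ℕ, (T : ℝ) ≤ C * (R * √(L / (n * ε))) ∧
          ∀ (d : ℕ) (X : Set (Recapp.Euc d)) (f : Fin n → Recapp.Euc d → ℝ),
            Recapp.IsFiniteSumProblem X f L R →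
            ∀ xinit ∈ X,
              (Recapp.recappSvrg X f L xinit T).ResultIn X ∧
              (Recapp.recappSvrg X f L xinit T).expectation (Recapp.gap X f)
                ≤ ENNReal.ofReal ε ∧
              (Recapp.recappSvrg X f L xinit T).expectedQueries
                ≤ ENNReal.ofReal
                    (C * (n * max 1 (Real.log (Real.log n)) + √(n * L * R ^ 2 / ε)))) ∧
    (∀ c : ℝ, 0 < c → ∃ C : ℝ, 0 < C ∧
      ∀ (n : ℕ) [NeZero n] (L R ε γ : ℝ), 0 < L → 0 ≤ R → 0 < ε → 0 < γ → γ ≤ c * (L / n) →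
        ∃ T K : ℕ,
          ∀ (d : ℕ) (X : Set (Recapp.Euc d)) (f : Fin n → Recapp.Euc d → ℝ),
            Recapp.IsFiniteSumProblem X f L R →
            StrongConvexOn X γ (Recapp.objective f) →
            ∀ xinit ∈ X,
              (Recapp.restartedRecappSvrg X f L xinit T K).ResultIn X ∧
              (Recapp.restartedRecappSvrg X f L xinit T K).expectation (Recapp.gap X f)
                ≤ ENNReal.ofReal ε ∧
              (Recapp.restartedRecappSvrg X f L xinit T K).expectedQueries
                ≤ ENNReal.ofReal
                    (C * (n * max 1 (Real.log (Real.log n))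
                      + √(n * L / γ) * max 0 (Real.log (L * R ^ 2 / (n * ε)))))) :=
  ⟨Recapp.recapp_convex_rate, Recapp.recapp_strongConvex_rate⟩
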